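/- Let $n\ge 1$ and write $(z,w)$ for the coordinates of $\mathbb C^{n+1}$, $z=(z_1,\dots,z_n)$, $w=u+iv$. Let $P_1,\dots,P_k$ be holomorphic polynomials in $z$, homogeneous of the same degree $d\ge 1$, put $Q(z,\bar z)=\sum_{l=1}^k P_l(z)\overline{P_l(z)}$ and $m=2d$, and assume $Q\not\equiv 0$. Suppose that the model hypersurface $M_0=\{(z,w)\in\mathbb C^{n+1} : v=Q(z,\bar z)\}$ is holomorphically nondegenerate at $0$, i.e. the only germ at $0$ of a holomorphic vector field $X=\sum_j X_j(z,w)\,\partial_{z_j}+X_0(z,w)\,\partial_w$ tangent to $M_0$ (that is, $X(v-Q)=0$ on $M_0$ near $0$) is $X=0$. Let $M\subset\mathbb C^{n+1}$ be any smooth perturbation of $M_0$, i.e. a hypersurface given near $0$ by $v=\psi(z,\bar z,u)$, where $\psi$ is a real-valued $C^\infty$ function near $0$ such that all derivatives $$\frac{\partial^{|\alpha|+|\beta|+l}(\psi-Q)}{\partial z^{\alpha}\,\partial\bar z^{\beta}\,\partial u^{l}}(0),\qquad l+\frac{|\alpha|+|\beta|}{m}\le 1,$$ vanish. Let $\mathrm{Aut}(M,0)$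 be the set of germs at $0$ of biholomorphisms of $\mathbb C^{n+1}$ that fix $0$ and map $M$ into itself. Then every element of $\mathrm{Aut}(M,0)$ is uniquely determined by its $2$-jet at $0$: if $F,G\in\mathrm{Aut}(M,0)$ have the same partial derivatives at $0$ of all orders $\le 2$, then $F=G$ as germs at $0$. -/

import Mathlib

open Filter Topology
open scoped ContDiff

namespace CRModel

/-- The space `ℂⁿ⁺¹` with coordinates `(z, w)`, where `z ∈ ℂⁿ` and `w = u + iv ∈ ℂ`.
(The choice of a norm plays no role: only germs, derivatives and analyticity are used.) -/
abbrev Cn1 (n : ℕ) : Type := (Fin n → ℂ) × ℂ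

/-- The sum of squares `Q(z, z̄) = ∑ₗ Pₗ(z) \overline{Pₗ(z)}`, as a real-valued function of `z`. -/
noncomputable def sumOfSquares {n k : ℕ} (P : Fin k → MvPolynomial (Fin n) ℂ)
    (z : Fin n → ℂ) : ℝ :=
  ∑ l, ‖MvPolynomial.eval z (P l)‖ ^ 2

/-- The defining function `v - Q(z, z̄)` of the model hypersurface `v = Q(z, z̄)`. -/
def modelDefiningFunction {n : ℕ} (Q : (Fin n → ℂ) → ℝ) (p : Cn1 n) : ℝ :=
  p.2.im - Q p.1

/-- `X` is (a representative of) a germ at `p` of a holomorphic vector field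
`∑ⱼ X_j ∂_{z_j} + X_w ∂_w` that is tangent to the hypersurface `{ρ = 0}`, i.e. `X ρ = 0` on
`{ρ = 0}` near `p`. A `(1,0)`-field `X` satisfies `X ρ = 0` at `q` exactly when the real
directional derivatives of `ρ` at `q` along the vectors `X(q)` and `i X(q)` both vanish. -/
def IsTangentHolomorphicField {n : ℕ} (ρ : Cn1 n → ℝ) (p : Cn1 n) (X : Cn1 n → Cn1 n) : Prop :=
  AnalyticAt ℂ X p ∧
    ∀ᶠ q in 𝓝 p, ρ q = 0 →
      fderiv ℝ ρ q (X q) = 0 ∧ fderiv ℝ ρ q (Complex.I • X q) = 0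

/-- The hypersurface `{ρ = 0}` is holomorphically nondegenerate at `p`: there is no nonzero germ
at `p` of a holomorphic vector field tangent to it. -/
def HolomorphicallyNondegenerateAt {n : ℕ} (ρ : Cn1 n → ℝ) (p : Cn1 n) : Prop :=
  ∀ X : Cn1 n → Cn1 n, IsTangentHolomorphicField ρ p X → X =ᶠ[𝓝 p] 0

/-- All derivatives at `0` of `r(z, z̄, u)` of weighted order at most one vanish, where `z` has
weight `1/m` and `u` has weight `1`: a derivative taken `j` times in (real) directions of the
`z`-space and `l` times in `u` has weighted order `l + j/m`. (For a smooth function, the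
derivatives `∂_z^α ∂_{z̄}^β` with `|α| + |β| = j` and the `j`-fold real directional derivatives
in the `z`-space span the same space.) -/
def WeightedDerivativesVanish {n : ℕ} (m : ℕ) (r : (Fin n → ℂ) × ℝ → ℝ) : Prop :=
  ∀ j l : ℕ, (l : ℚ) + (j : ℚ) / (m : ℚ) ≤ 1 →
    ∀ v : Fin j → (Fin n → ℂ),
      iteratedFDeriv ℝ (j + l) r 0
        (Fin.append (fun i => ((v i, 0) : (Fin n → ℂ) × ℝ)) (fun _ => (0, 1))) = 0

/-- `M` is a smooth perturbation of the model `v = Q(z, z̄)`, with `Q` homogeneous of degree `m`: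
near `0`, `M` is the graph `v = ψ(z, z̄, u)` of a smooth real-valued `ψ = Q + o(1)`, where `o(1)`
is a smooth function whose derivatives at `0` of weighted order at most one vanish. -/
def IsSmoothPerturbation {n : ℕ} (m : ℕ) (Q : (Fin n → ℂ) → ℝ) (M : Set (Cn1 n)) : Prop :=
  ∃ ψ : (Fin n → ℂ) × ℝ → ℝ,
    (∃ U : Set ((Fin n → ℂ) × ℝ), IsOpen U ∧ (0 : (Fin n → ℂ) × ℝ) ∈ U ∧ ContDiffOn ℝ ∞ ψ U) ∧
    WeightedDerivativesVanish m (fun x => ψ x - Q x.1) ∧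
    ∀ᶠ p : Cn1 n in 𝓝 0, p ∈ M ↔ p.2.im = ψ (p.1, p.2.re)

/-- `F` represents an element of the stability group `Aut(M, 0)`: a germ at `0` of a
biholomorphism fixing `0` and mapping `M` into itself. -/
def IsLocalAutomorphism {n : ℕ} (M : Set (Cn1 n)) (F : Cn1 n → Cn1 n) : Prop :=
  AnalyticAt ℂ F 0 ∧ F 0 = 0 ∧
    (∃ G : Cn1 n → Cn1 n, AnalyticAt ℂ G 0 ∧ G 0 = 0 ∧
      (∀ᶠ p in 𝓝 0, G (F p) = p) ∧ (∀ᶠ p in 𝓝 0, F (G p) = p)) ∧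
    ∀ᶠ p in 𝓝 0, p ∈ M → F p ∈ M

/-- `F` and `G` have the same `k`-jet at `p`: their holomorphic derivatives at `p` of all orders
at most `k` coincide. -/
def SameJet {n : ℕ} (k : ℕ) (F G : Cn1 n → Cn1 n) (p : Cn1 n) : Prop :=
  ∀ i ≤ k, iteratedFDeriv ℂ i F p = iteratedFDeriv ℂ i G p

end CRModel

namespace CRModel

open ComplexConjugate Complex

/-! Put `H = F⁻¹ ∘ G = id + K`. Equality of 2-jets gives `K = O(‖x‖³)`, and `H` preserves `M`, so it
suffices that such a `K` vanishes.

Give `z` weight 1 and `w` weight `m = 2d`, and expand `(t^{m-1} K₁(tz, t^m w), K₂(tz, t^m w))` in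
powers of `t`. If all coefficients below order `N` vanish, divide the invariance equation of `M`
along the points over `(tz, t^m u)` by `t^N` and let `t → 0`. The perturbation disappears, and the
coefficient `Y = (f, g)` of order `N` satisfies `Im g = dQ(f)` on the model
(`tangency_of_leading_component`). `Y` is entire and still vanishes to third order at 0.

Such a `Y` is zero. Write `p = (P₁, …, P_k)` and `⟨a, b⟩` for `herm`. Polarization gives an identity
between the values at `(z, w)` and `(η, σ)` whenever `w - σ̄ = 2i⟨p(z), p(η)⟩`. This relation is
invariant under `(z, η) ↦ (tz, η/t̄)`. For `σ = 0`, third-order vanishing makes the `η`-terms decay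
as `t → ∞`, and Liouville's theorem decouples the identity: `g(z, w)⟨p(z), p(η)⟩ = w⟨dp(f), p(η)⟩`.
Substituted back, this gives `g(z, w)τ² = conj(g(η, τ̄)) w²` with `τ = σ̄`. A second use of
Liouville moves `η` to 0, and `τ → 0` gives `g = 0`. Then `dp(f)` is orthogonal to `p(η)` for `η`
near `z`; differentiating in `η` along `f` gives `⟨dp(f), dp(f)⟩ = 0` (`annihilates_of_polarized`).
So `f` is tangent to the model, and nondegeneracy makes it zero. By induction every coefficient of
`K` vanishes. -/

/-- The standard Hermitian form on `ℂᵏ`, linear in the first argument. -/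
noncomputable def herm {k : ℕ} (a b : Fin k → ℂ) : ℂ := ∑ l, a l * conj (b l)

/-! ### Sesquilinear algebra of the pairing -/

section Herm

variable {k : ℕ}

lemma herm_smul_left (c : ℂ) (a b : Fin k → ℂ) : herm (c • a) b = c * herm a b := by
  simp [herm, Finset.mul_sum, mul_assoc]

lemma herm_smul_right (c : ℂ) (a b : Fin k → ℂ) : herm a (c • b) = conj c * herm a b := by
  simp only [herm, Finset.mul_sum, Pi.smul_apply, smul_eq_mul, map_mul]
  exact Finset.sum_congr rfl fun _ _ => by ring

lemma conj_herm (a b : Fin k → ℂ) : conj (herm a b) = herm b a := by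
  simp [herm, mul_comm]

lemma herm_self (a : Fin k → ℂ) : herm a a = ((∑ l, ‖a l‖ ^ 2 : ℝ) : ℂ) := by
  simp [herm, Complex.mul_conj, Complex.normSq_eq_norm_sq]

lemma herm_self_eq_zero {a : Fin k → ℂ} : herm a a = 0 ↔ a = 0 := by
  rw [herm_self, Complex.ofReal_eq_zero, Finset.sum_eq_zero_iff_of_nonneg fun _ _ => by positivity]
  simp [funext_iff]

lemma continuous_herm {X : Type*} [TopologicalSpace X] {a b : X → Fin k → ℂ}
    (ha : Continuous a) (hb : Continuous b) : Continuous fun x => herm (a x) (b x) := by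
  unfold herm
  fun_prop

end Herm

/-! ### Polarization of the tangency equation -/

/-- An entire function on `ℂ` that vanishes on the real line vanishes identically. -/
lemma eq_zero_of_real_zeros {Θ : ℂ → ℂ} (hΘ : Differentiable ℂ Θ) (h : ∀ x : ℝ, Θ x = 0) (c : ℂ) :
    Θ c = 0 := by
  have ha : AnalyticOnNhd ℂ Θ Set.univ := fun x _ => hΘ.analyticAt x
  have : Θ = 0 := by
    refine ha.eq_of_frequently_eq (z₀ := 0) (fun _ _ => analyticAt_const) ?_
    have h1 : Tendsto (fun x : ℝ => (x : ℂ)) (𝓝[≠] 0) (𝓝[≠] 0) := by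
      refine tendsto_nhdsWithin_iff.2 ⟨?_, ?_⟩
      · exact (Complex.continuous_ofReal.tendsto' 0 0 (by simp)).mono_left nhdsWithin_le_nhds
      · filter_upwards [self_mem_nhdsWithin] with x hx
        simpa using hx
    exact h1.frequently (Frequently.of_forall fun x => h x)
  simp [this]

section Algebra

variable {n k d : ℕ} {p : (Fin n → ℂ) → Fin k → ℂ} {f : Cn1 n → Fin n → ℂ} {g : Cn1 n → ℂ}

/-- The polarization of the tangency equation for an entire field along `Im w = ‖p z‖²`. -/
lemma polarized_tangency (hp : AnalyticOnNhd ℂ p Set.univ) (hf : Differentiable ℂ f)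
    (hg : Differentiable ℂ g)
    (htan : ∀ (z : Fin n → ℂ) (u : ℝ), (g (z, u + I * herm (p z) (p z))).im =
      2 * (herm (fderiv ℂ p z (f (z, u + I * herm (p z) (p z)))) (p z)).re)
    {z η : Fin n → ℂ} {w σ : ℂ} (hwσ : w - conj σ = 2 * I * herm (p z) (p η)) :
    g (z, w) - conj (g (η, σ)) =
      2 * I * (herm (fderiv ℂ p z (f (z, w))) (p η) +
        conj (herm (fderiv ℂ p η (f (η, σ))) (p z))) := by
  have hpd : Differentiable ℂ p := fun x => (hp x trivial).differentiableAt
  have hpd' : Differentiable ℂ (fderiv ℂ p) := fun x => (hp.fderiv x trivial).differentiableAt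
  -- Complex line `c ↦ za + c • zb` through `z` at `c = I` and `η` at `c = -I`. Conjugated
  -- quantities are evaluated at `conj c`, so everything is holomorphic in `c`. Real `c` gives the
  -- tangency equation on the model, and `c = I` gives the polarized one, with `W I = w` and `W (-I)
  -- = σ`.
  set za : Fin n → ℂ := (2⁻¹ : ℂ) • (z + η) with hza
  set zb : Fin n → ℂ := (-(I * 2⁻¹) : ℂ) • (z - η) with hzb
  set uc : ℂ := w - I * herm (p z) (p η) with huc
  set zc : ℂ → Fin n → ℂ := fun c => za + c • zb with hzc
  set q : ℂ → Fin k → ℂ := fun c => p (zc c) with hq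
  set S : ℂ → ℂ := fun c => ∑ l, q c l * conj (q (conj c) l) with hS
  set W : ℂ → ℂ := fun c => uc.re + c * uc.im + I * S c with hW
  set A : ℂ → ℂ := fun c => g (zc c, W c) with hA
  set D : ℂ → Fin k → ℂ := fun c => fderiv ℂ p (zc c) (f (zc c, W c)) with hD
  have dconj : ∀ {φ : ℂ → ℂ}, Differentiable ℂ φ → Differentiable ℂ fun c => conj (φ (conj c)) := by
    intro φ hφ c
    have := (hφ (conj c)).conj_conj
    rw [Complex.conj_conj] at this
    exact this
  have dzc : Differentiable ℂ zc := by fun_prop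
  have dq : Differentiable ℂ q := hpd.comp dzc
  have dql : ∀ l, Differentiable ℂ fun c => q c l := fun l => differentiable_pi.1 dq l
  have dS : Differentiable ℂ S :=
    Differentiable.fun_sum fun l _ => (dql l).mul (dconj (dql l))
  have dW : Differentiable ℂ W := by fun_prop
  have dA : Differentiable ℂ A := hg.comp (dzc.prodMk dW)
  have dD : Differentiable ℂ D := (hpd'.comp dzc).clm_apply (hf.comp (dzc.prodMk dW))
  have dDl : ∀ l, Differentiable ℂ fun c => D c l := fun l => differentiable_pi.1 dD l
  set Θ : ℂ → ℂ := fun c => A c - conj (A (conj c)) - 2 * I *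
    ((∑ l, D c l * conj (q (conj c) l)) + ∑ l, conj (D (conj c) l) * q c l) with hΘ
  have dΘ : Differentiable ℂ Θ := by
    refine (dA.sub (dconj dA)).sub (Differentiable.const_mul (Differentiable.add ?_ ?_) _)
    · exact Differentiable.fun_sum fun l _ => (dDl l).mul (dconj (dql l))
    · exact Differentiable.fun_sum fun l _ => (dconj (dDl l)).mul (dql l)
  have hreal : ∀ x : ℝ, Θ x = 0 := by
    intro x
    have h := htan (zc x) (uc.re + x * uc.im)
    have hWx : W x = ((uc.re + x * uc.im : ℝ) : ℂ) + I * herm (p (zc x)) (p (zc x)) := by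
      simp [hW, hS, hq, herm]
    rw [← hWx] at h
    have h1 : A x - conj (A x) = 2 * I * ((A x).im : ℂ) := by
      rw [Complex.sub_conj]; push_cast; ring
    have h2 : (∑ l, D x l * conj (q x l)) + ∑ l, conj (D x l) * q x l =
        ((2 * (herm (D x) (q x)).re : ℝ) : ℂ) := by
      rw [← Complex.add_conj, conj_herm]
      simp [herm, mul_comm]
    simp only [hΘ, Complex.conj_ofReal]
    rw [h1, h2, ← h]
    ring
  have key := eq_zero_of_real_zeros dΘ hreal I
  have z1 : zc I = z := by
    have : I * (-(I * 2⁻¹)) = (2⁻¹ : ℂ) := by linear_combination (-(2⁻¹ : ℂ)) * I_mul_I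
    simp only [hzc, hza, hzb, smul_smul, this]
    rw [← smul_add]
    ext i
    simp
    ring
  have z2 : zc (-I) = η := by
    have : -I * (-(I * 2⁻¹)) = -(2⁻¹ : ℂ) := by linear_combination ((2⁻¹ : ℂ)) * I_mul_I
    simp only [hzc, hza, hzb, smul_smul, this]
    ext i
    simp
    ring
  have s1 : S I = herm (p z) (p η) := by simp [hS, hq, herm, z1, z2]
  have s2 : S (-I) = conj (herm (p z) (p η)) := by
    rw [conj_herm]; simp [hS, hq, herm, z1, z2]
  have w1 : W I = w := by
    have := Complex.re_add_im uc
    simp only [hW, s1]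
    rw [mul_comm I (uc.im : ℂ), this, huc]
    ring
  have w2 : W (-I) = σ := by
    have h3 : (uc.re : ℂ) + -I * uc.im = conj uc := by
      apply Complex.ext <;> simp
    have h4 : σ = conj (w - 2 * I * herm (p z) (p η)) := by
      rw [← hwσ]; simp
    simp only [hW, s2]
    rw [h3, h4, huc]
    simp only [map_sub, map_mul, Complex.conj_I, map_ofNat]
    ring
  simp only [hΘ, Complex.conj_I, hA, hD, hq, z1, z2, w1, w2] at key
  rw [sub_eq_zero] at key
  rw [key, conj_herm]
  simp [herm, mul_comm]

end Algebra

/-! ### Infinitesimal automorphisms of the model vanishing to third order -/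

lemma norm_herm_le {k : ℕ} (a b : Fin k → ℂ) : ‖herm a b‖ ≤ (∑ l, ‖b l‖) * ‖a‖ := by
  rw [herm, Finset.sum_mul]
  refine (norm_sum_le _ _).trans (Finset.sum_le_sum fun l _ => ?_)
  rw [norm_mul, RCLike.norm_conj, mul_comm]
  exact mul_le_mul_of_nonneg_left (norm_le_pi_norm a l) (norm_nonneg _)

lemma tendsto_conj_inv_cocompact : Tendsto (fun t : ℂ => (conj t)⁻¹) (cocompact ℂ) (𝓝 0) := by
  have h : Tendsto (fun t : ℂ => conj (t⁻¹)) (cocompact ℂ) (𝓝 0) := by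
    have h1 : Tendsto (fun t : ℂ => t⁻¹) (cocompact ℂ) (𝓝 0) := by
      rw [← Metric.cobounded_eq_cocompact]
      exact tendsto_inv₀_cobounded
    exact (Complex.continuous_conj.tendsto' 0 0 (by simp)).comp h1
  simpa [map_inv₀] using h

/-- A map vanishing to third order at the origin beats quadratic growth after inversion. -/
lemma tendsto_pow_mul_norm_comp_inv {n : ℕ} {F : Type*} [NormedAddCommGroup F] {G : Cn1 n → F}
    (hG : G =O[𝓝 0] fun x => ‖x‖ ^ 3) (η : Fin n → ℂ) {j : ℕ} (hj : j ≤ 2) :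
    Tendsto (fun t : ℂ => ‖t‖ ^ j * ‖G ((conj t)⁻¹ • η, 0)‖) (cocompact ℂ) (𝓝 0) := by
  obtain ⟨C, hC⟩ := hG.bound
  have h0 : Tendsto (fun t : ℂ => (((conj t)⁻¹ • η, 0) : Cn1 n)) (cocompact ℂ) (𝓝 0) := by
    have := (tendsto_conj_inv_cocompact.smul_const η).prodMk_nhds (tendsto_const_nhds (x := (0 : ℂ)))
    rwa [zero_smul] at this
  have hlim : Tendsto (fun t : ℂ => C * ‖η‖ ^ 3 * ‖(conj t)⁻¹‖ ^ (3 - j)) (cocompact ℂ) (𝓝 0) := by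
    have h1 : Tendsto (fun t : ℂ => ‖(conj t)⁻¹‖ ^ (3 - j)) (cocompact ℂ) (𝓝 0) := by
      have := (tendsto_conj_inv_cocompact.norm).pow (3 - j)
      rwa [norm_zero, zero_pow (by omega)] at this
    simpa using h1.const_mul (C * ‖η‖ ^ 3)
  have hne : ∀ᶠ t : ℂ in cocompact ℂ, t ≠ 0 := by
    have : ({0} : Set ℂ)ᶜ ∈ cocompact ℂ := isCompact_singleton.compl_mem_cocompact
    exact this
  refine squeeze_zero' (Eventually.of_forall fun t => by positivity) ?_ hlim
  filter_upwards [h0.eventually hC, hne] with t ht htne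
  have hn : ‖(((conj t)⁻¹ • η, 0) : Cn1 n)‖ = ‖t‖⁻¹ * ‖η‖ := by
    rw [Prod.norm_mk, norm_zero, max_eq_left (norm_nonneg _), norm_smul, norm_inv, RCLike.norm_conj]
  rw [hn, norm_pow, Real.norm_of_nonneg (by positivity)] at ht
  have htp : 0 < ‖t‖ := norm_pos_iff.2 htne
  calc ‖t‖ ^ j * ‖G ((conj t)⁻¹ • η, 0)‖ ≤ ‖t‖ ^ j * (C * (‖t‖⁻¹ * ‖η‖) ^ 3) := by gcongr
    _ = C * ‖η‖ ^ 3 * ‖(conj t)⁻¹‖ ^ (3 - j) := by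
      rw [norm_inv, RCLike.norm_conj, mul_pow]
      have : (‖t‖⁻¹) ^ 3 = (‖t‖⁻¹) ^ j * (‖t‖⁻¹) ^ (3 - j) := by
        rw [← pow_add]; congr 1; omega
      rw [this]
      have h2 : ‖t‖ ^ j * (‖t‖⁻¹) ^ j = 1 := by
        rw [← mul_pow, mul_inv_cancel₀ htp.ne', one_pow]
      linear_combination (C * ‖η‖ ^ 3 * (‖t‖⁻¹) ^ (3 - j)) * h2

section Algebra

variable {n k d : ℕ} {p : (Fin n → ℂ) → Fin k → ℂ} {f : Cn1 n → Fin n → ℂ} {g : Cn1 n → ℂ}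

lemma fderiv_smul_of_homogeneous (hp : Differentiable ℂ p)
    (hom : ∀ (c : ℂ) z, p (c • z) = c ^ d • p z) {c : ℂ} (hc : c ≠ 0) (z ξ : Fin n → ℂ) :
    fderiv ℂ p (c • z) ξ = (c ^ d * c⁻¹) • fderiv ℂ p z ξ := by
  have h1 : HasFDerivAt (fun y => p (c • y))
      ((fderiv ℂ p (c • z)).comp (c • ContinuousLinearMap.id ℂ (Fin n → ℂ))) z :=
    (hp (c • z)).hasFDerivAt.comp z ((hasFDerivAt_id z).const_smul c)
  have h2 : HasFDerivAt (fun y => p (c • y)) (c ^ d • fderiv ℂ p z) z := by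
    simp only [hom]
    exact (hp z).hasFDerivAt.const_smul (c ^ d)
  have h3 := congrArg (fun L => L ξ) (h1.unique h2)
  simp only [ContinuousLinearMap.comp_apply, _root_.smul_apply,
    ContinuousLinearMap.id_apply, map_smul] at h3
  rw [mul_comm, ← smul_smul, ← h3, smul_smul, inv_mul_cancel₀ hc, one_smul]

/-- Rescaling `η = conj c • z` multiplies the pairing by `c ^ d`, and `ℂ` has all `d`-th roots. -/
lemma exists_herm_eq (hd : 1 ≤ d) (hom : ∀ (c : ℂ) z, p (c • z) = c ^ d • p z)
    {z : Fin n → ℂ} (hz : p z ≠ 0) (a : ℂ) : ∃ η, herm (p z) (p η) = a := by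
  have hS : herm (p z) (p z) ≠ 0 := fun h => hz (herm_self_eq_zero.1 h)
  obtain ⟨c, hc⟩ := IsAlgClosed.exists_pow_nat_eq (a / herm (p z) (p z)) (n := d) (by omega)
  refine ⟨conj c • z, ?_⟩
  rw [hom, herm_smul_right, ← map_pow, Complex.conj_conj, hc, div_mul_cancel₀ _ hS]

/-- The noncompact symmetry of the polarized relation: it sends `z` to infinity while `η` tends to
0, and makes the Liouville arguments possible. -/
lemma herm_smul_inv_smul (hom : ∀ (c : ℂ) z, p (c • z) = c ^ d • p z) {t : ℂ} (ht : t ≠ 0)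
    (z η : Fin n → ℂ) : herm (p (t • z)) (p ((conj t)⁻¹ • η)) = herm (p z) (p η) := by
  rw [hom, hom, herm_smul_left, herm_smul_right]
  simp only [map_pow, map_inv₀, Complex.conj_conj]
  rw [← mul_assoc, ← mul_pow, mul_inv_cancel₀ ht, one_pow, one_mul]

/-- On the locus `σ = 0` of the polarized equation the two sides decouple. -/
lemma decoupled_tangency (hp : AnalyticOnNhd ℂ p Set.univ)
    (hom : ∀ (c : ℂ) z, p (c • z) = c ^ d • p z)
    (hf : Differentiable ℂ f) (hg : Differentiable ℂ g)
    (hf3 : f =O[𝓝 0] fun x => ‖x‖ ^ 3) (hg3 : g =O[𝓝 0] fun x => ‖x‖ ^ 3)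
    (hpol : ∀ (z η : Fin n → ℂ) (w σ : ℂ), w - conj σ = 2 * I * herm (p z) (p η) →
      g (z, w) - conj (g (η, σ)) =
      2 * I * (herm (fderiv ℂ p z (f (z, w))) (p η) +
        conj (herm (fderiv ℂ p η (f (η, σ))) (p z))))
    {z η : Fin n → ℂ} {w : ℂ} (hw : w = 2 * I * herm (p z) (p η)) :
    g (z, w) = 2 * I * herm (fderiv ℂ p z (f (z, w))) (p η) := by
  have hpd : Differentiable ℂ p := fun x => (hp x trivial).differentiableAt
  -- After the substitution `(t • z, (conj t)⁻¹ • η)` the `f(z, w)` term carries `t⁻¹` by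
  -- homogeneity. The extra factor `t` clears it, so `φ` is entire. The other side then carries `t`
  -- and `t²`, the latter being what cubic vanishing of `f` absorbs.
  set φ : ℂ → ℂ := fun t => t * g (t • z, w) - 2 * I * herm (fderiv ℂ p z (f (t • z, w))) (p η)
    with hφ
  have dφ : Differentiable ℂ φ := by
    have d1 : Differentiable ℂ fun t : ℂ => ((t • z, w) : Cn1 n) := by fun_prop
    have d2 : Differentiable ℂ fun t : ℂ => fderiv ℂ p z (f (t • z, w)) :=
      (fderiv ℂ p z).differentiable.comp (hf.comp d1)
    refine (differentiable_id.mul (hg.comp d1)).sub (Differentiable.const_mul ?_ _)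
    exact Differentiable.fun_sum fun l _ => (differentiable_pi.1 d2 l).mul_const _
  have hφ' : ∀ t : ℂ, t ≠ 0 → φ t = t * conj (g ((conj t)⁻¹ • η, 0)) +
      2 * I * t ^ 2 * conj (herm (fderiv ℂ p η (f ((conj t)⁻¹ • η, 0))) (p z)) := by
    intro t ht
    have htc : (conj t)⁻¹ ≠ 0 := inv_ne_zero (by simpa using ht)
    have h := hpol (t • z) ((conj t)⁻¹ • η) w 0
      (by rw [herm_smul_inv_smul hom ht, map_zero, sub_zero, hw])
    rw [fderiv_smul_of_homogeneous hpd hom ht, fderiv_smul_of_homogeneous hpd hom htc, hom, hom] at h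
    simp only [herm_smul_left, herm_smul_right, map_pow, map_inv₀, Complex.conj_conj, map_mul,
      inv_inv] at h
    have e1 : t ^ d * (t⁻¹) ^ d = 1 := by rw [← mul_pow, mul_inv_cancel₀ ht, one_pow]
    have e2 : t * t⁻¹ = 1 := mul_inv_cancel₀ ht
    simp only [hφ]
    linear_combination t * h +
      (2 * I * herm (fderiv ℂ p z (f (t • z, w))) (p η)) * ((t * t⁻¹) * e1 + e2) +
      (2 * I * t ^ 2 * conj (herm (fderiv ℂ p η (f ((conj t)⁻¹ • η, 0))) (p z))) * e1
  have hne : ∀ᶠ t : ℂ in cocompact ℂ, t ≠ 0 := by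
    have : ({0} : Set ℂ)ᶜ ∈ cocompact ℂ := isCompact_singleton.compl_mem_cocompact
    exact this
  have hlim : Tendsto φ (cocompact ℂ) (𝓝 0) := by
    have l1 := tendsto_pow_mul_norm_comp_inv hg3 η (j := 1) (by norm_num)
    have l2 := (tendsto_pow_mul_norm_comp_inv hf3 η (j := 2) le_rfl).const_mul
      (2 * ((∑ l, ‖p z l‖) * ‖fderiv ℂ p η‖))
    have l3 := l1.add l2
    rw [mul_zero, add_zero] at l3
    refine squeeze_zero_norm' ?_ l3
    filter_upwards [hne] with t ht
    rw [hφ' t ht]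
    refine (norm_add_le _ _).trans (add_le_add ?_ ?_)
    · rw [norm_mul, RCLike.norm_conj, pow_one]
    · rw [norm_mul, RCLike.norm_conj, norm_mul, norm_mul, norm_pow, Complex.norm_I]
      have b1 := norm_herm_le (fderiv ℂ p η (f ((conj t)⁻¹ • η, 0))) (p z)
      have b2 := (fderiv ℂ p η).le_opNorm (f ((conj t)⁻¹ • η, 0))
      have b3 : ‖herm (fderiv ℂ p η (f ((conj t)⁻¹ • η, 0))) (p z)‖ ≤
          (∑ l, ‖p z l‖) * (‖fderiv ℂ p η‖ * ‖f ((conj t)⁻¹ • η, 0)‖) :=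
        b1.trans (by gcongr)
      calc ‖(2 : ℂ)‖ * 1 * ‖t‖ ^ 2 * ‖herm (fderiv ℂ p η (f ((conj t)⁻¹ • η, 0))) (p z)‖
          ≤ ‖(2 : ℂ)‖ * 1 * ‖t‖ ^ 2 *
            ((∑ l, ‖p z l‖) * (‖fderiv ℂ p η‖ * ‖f ((conj t)⁻¹ • η, 0)‖)) := by gcongr
        _ = _ := by rw [Complex.norm_ofNat]; ring
  -- Liouville: an entire function tending to 0 at infinity is zero; evaluate at `t = 1`.
  have := dφ.apply_eq_of_tendsto_cocompact 1 hlim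
  simp only [hφ, one_smul, one_mul] at this
  exact sub_eq_zero.1 this

/-- A field satisfying the polarized tangency equation and vanishing to third order at the origin
has no `w`-component and annihilates `p`. -/
theorem annihilates_of_polarized (hd : 1 ≤ d) (hp : AnalyticOnNhd ℂ p Set.univ)
    (hom : ∀ (c : ℂ) z, p (c • z) = c ^ d • p z) (hne : ∃ z, p z ≠ 0)
    (hf : Differentiable ℂ f) (hg : Differentiable ℂ g)
    (hf3 : f =O[𝓝 0] fun x => ‖x‖ ^ 3) (hg3 : g =O[𝓝 0] fun x => ‖x‖ ^ 3)
    (hpol : ∀ (z η : Fin n → ℂ) (w σ : ℂ), w - conj σ = 2 * I * herm (p z) (p η) →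
      g (z, w) - conj (g (η, σ)) =
      2 * I * (herm (fderiv ℂ p z (f (z, w))) (p η) +
        conj (herm (fderiv ℂ p η (f (η, σ))) (p z))))
    (x : Cn1 n) : g x = 0 ∧ fderiv ℂ p x.1 (f x) = 0 := by
  have hpd : Differentiable ℂ p := fun x => (hp x trivial).differentiableAt
  -- The constraint tying `w` to `η` is removed by rescaling `η`, so `w` becomes free.
  have dec : ∀ (z η : Fin n → ℂ) (w : ℂ), herm (p z) (p η) ≠ 0 →
      g (z, w) * herm (p z) (p η) = w * herm (fderiv ℂ p z (f (z, w))) (p η) := by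
    intro z η w hS
    obtain ⟨c, hc⟩ := IsAlgClosed.exists_pow_nat_eq (w / (2 * I * herm (p z) (p η))) (n := d)
      (by omega)
    have h2 : (2 * I * herm (p z) (p η)) ≠ 0 := by simp [hS]
    have hpe : p (conj c • η) = conj (w / (2 * I * herm (p z) (p η))) • p η := by
      rw [hom, ← map_pow, hc]
    have h := decoupled_tangency hp hom hf hg hf3 hg3 hpol (z := z) (η := conj c • η) (w := w)
      (by rw [hpe, herm_smul_right, Complex.conj_conj]; field_simp)
    rw [hpe, herm_smul_right, Complex.conj_conj] at h
    rw [h]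
    field_simp
  -- Insert the decoupled identity at both `(z, w)` and `(η, conj τ)` into the polarized equation;
  -- the mixed terms `w * τ` cancel.
  have sq : ∀ (z η : Fin n → ℂ) (w τ : ℂ), w ≠ 0 → τ ≠ 0 → w ≠ τ →
      w - τ = 2 * I * herm (p z) (p η) → g (z, w) * τ ^ 2 = conj (g (η, conj τ)) * w ^ 2 := by
    intro z η w τ hw hτ hne h
    have hS : herm (p z) (p η) ≠ 0 := by
      intro h0
      rw [h0, mul_zero, sub_eq_zero] at h
      exact hne h
    have hS' : herm (p η) (p z) ≠ 0 := by
      rw [← conj_herm]; simpa using hS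
    have e := hpol z η w (conj τ) (by rw [Complex.conj_conj, h])
    have e1 := dec z η w hS
    have e2 := congrArg conj (dec η z (conj τ) hS')
    rw [map_mul, map_mul, conj_herm, Complex.conj_conj] at e2
    have e3 : (g (z, w) - conj (g (η, conj τ))) * (w * τ) = (w - τ) *
        (g (z, w) * τ + conj (g (η, conj τ)) * w) := by
      rw [e, h]
      linear_combination (-2 * I * τ) * e1 - (2 * I * w) * e2
    linear_combination e3
  -- As `t → ∞` the point `(conj t)⁻¹ • η` tends to 0, so `t ↦ g (t • z, w)` has a finite limit at
  -- infinity and is constant.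
  have lim : ∀ (z η : Fin n → ℂ) (w τ : ℂ), w ≠ 0 → τ ≠ 0 → w ≠ τ →
      w - τ = 2 * I * herm (p z) (p η) →
      ∀ t : ℂ, g (t • z, w) = conj (g (0, conj τ)) * w ^ 2 / τ ^ 2 := by
    intro z η w τ hw hτ hne h t
    have d1 : Differentiable ℂ fun t : ℂ => ((t • z, w) : Cn1 n) := by fun_prop
    refine (hg.comp d1).apply_eq_of_tendsto_cocompact t ?_
    have hne : ∀ᶠ t : ℂ in cocompact ℂ, t ≠ 0 := by
      have : ({0} : Set ℂ)ᶜ ∈ cocompact ℂ := isCompact_singleton.compl_mem_cocompact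
      exact this
    have l1 : Tendsto (fun t : ℂ => conj (g ((conj t)⁻¹ • η, conj τ)) * w ^ 2 / τ ^ 2)
        (cocompact ℂ) (𝓝 (conj (g (0, conj τ)) * w ^ 2 / τ ^ 2)) := by
      have c1 : Continuous fun s : ℂ => conj (g (s • η, conj τ)) * w ^ 2 / τ ^ 2 := by
        have := hg.continuous
        fun_prop
      refine (c1.tendsto' 0 _ ?_).comp tendsto_conj_inv_cocompact
      simp
    refine l1.congr' ?_
    filter_upwards [hne] with t ht
    have h3 := sq (t • z) ((conj t)⁻¹ • η) w τ hw hτ ‹_› (by rw [herm_smul_inv_smul hom ht, h])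
    rw [← h3]
    simp [hτ]
  have lim2 : ∀ (z : Fin n → ℂ) (w τ : ℂ), p z ≠ 0 → w ≠ 0 → τ ≠ 0 → w ≠ τ →
      ∀ t : ℂ, g (t • z, w) = conj (g (0, conj τ)) * w ^ 2 / τ ^ 2 := by
    intro z w τ hz hw hτ hne
    obtain ⟨η, hη⟩ := exists_herm_eq hd hom hz ((w - τ) / (2 * I))
    exact lim z η w τ hw hτ hne (by rw [hη]; field_simp)
  have gz : ∀ (z : Fin n → ℂ) (w : ℂ), p z ≠ 0 → w ≠ 0 → g (z, w) = 0 := by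
    intro z w hz hw
    -- The left side of `lim2` does not involve `τ`, and cubic vanishing of `g` beats `τ ^ 2`.
    have l1 : Tendsto (fun τ : ℂ => conj (g (0, conj τ)) * w ^ 2 / τ ^ 2) (𝓝[≠] 0) (𝓝 0) := by
      obtain ⟨C, hC⟩ := hg3.bound
      have h0 : Tendsto (fun τ : ℂ => ((0, conj τ) : Cn1 n)) (𝓝[≠] 0) (𝓝 0) := by
        have c : Continuous (fun τ : ℂ => ((0, conj τ) : Cn1 n)) := by fun_prop
        exact (c.tendsto' 0 0 (by simp)).mono_left nhdsWithin_le_nhds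
      have h1 : Tendsto (fun τ : ℂ => C * ‖w‖ ^ 2 * ‖τ‖) (𝓝[≠] 0) (𝓝 0) := by
        have c : Continuous (fun τ : ℂ => C * ‖w‖ ^ 2 * ‖τ‖) := by fun_prop
        exact (c.tendsto' 0 0 (by simp)).mono_left nhdsWithin_le_nhds
      refine squeeze_zero_norm' ?_ h1
      filter_upwards [h0.eventually hC, self_mem_nhdsWithin] with τ hτ hτ0
      have hτp : 0 < ‖τ‖ := norm_pos_iff.2 hτ0
      rw [norm_pow, norm_norm, Prod.norm_mk, norm_zero, max_eq_right (norm_nonneg _),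
        RCLike.norm_conj] at hτ
      rw [norm_div, norm_mul, RCLike.norm_conj, norm_pow, norm_pow, div_le_iff₀ (by positivity)]
      calc ‖g (0, conj τ)‖ * ‖w‖ ^ 2 ≤ C * ‖τ‖ ^ 3 * ‖w‖ ^ 2 := by gcongr
        _ = _ := by ring
    have l2 : Tendsto (fun τ : ℂ => conj (g (0, conj τ)) * w ^ 2 / τ ^ 2) (𝓝[≠] 0)
        (𝓝 (g (z, w))) := by
      refine tendsto_const_nhds.congr' ?_
      have hw' : ∀ᶠ τ : ℂ in 𝓝[≠] 0, τ ≠ w := (eventually_ne_nhds hw.symm).filter_mono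
        nhdsWithin_le_nhds
      filter_upwards [self_mem_nhdsWithin, hw'] with τ hτ hτw
      simpa using lim2 z w τ hz hw hτ hτw.symm 1
    exact tendsto_nhds_unique l2 l1
  have fz : ∀ (z : Fin n → ℂ) (w : ℂ), p z ≠ 0 → w ≠ 0 → fderiv ℂ p z (f (z, w)) = 0 := by
    intro z w hz hw
    set ξ := f (z, w)
    have hS : herm (p z) (p z) ≠ 0 := fun h => hz (herm_self_eq_zero.1 h)
    -- For small `s` the pairing of `p z` with `p (z + s • ξ)` stays nonzero, so `dec` and `g = 0`
    -- make the vector `fderiv ℂ p z ξ` orthogonal to `p (z + s • ξ)`. The derivative at `s = 0` is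
    -- its squared norm.
    have c1 : Continuous fun s : ℂ => herm (p z) (p (z + s • ξ)) :=
      continuous_herm continuous_const (hpd.continuous.comp (by fun_prop))
    have ev : ∀ᶠ s : ℂ in 𝓝 0, herm (p z) (p (z + s • ξ)) ≠ 0 :=
      c1.continuousAt.eventually_ne (by simpa using hS)
    have ev2 : (fun s : ℂ => herm (p (z + s • ξ)) (fderiv ℂ p z ξ)) =ᶠ[𝓝 0] fun _ => 0 := by
      filter_upwards [ev] with s hs
      have := dec z (z + s • ξ) w hs
      rw [gz z w hz hw, zero_mul] at this
      rw [← conj_herm, (mul_eq_zero.1 this.symm).resolve_left hw, map_zero]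
    have hd1 : HasDerivAt (fun s : ℂ => p (z + s • ξ)) (fderiv ℂ p z ξ) 0 := by
      have h1 : HasDerivAt (fun s : ℂ => z + s • ξ) ξ 0 := by
        simpa using ((hasDerivAt_id (0 : ℂ)).smul_const ξ).const_add z
      have h2 : HasFDerivAt p (fderiv ℂ p z) (z + (0 : ℂ) • ξ) := by
        simpa using (hpd z).hasFDerivAt
      exact h2.comp_hasDerivAt _ h1
    have hd2 : HasDerivAt (fun s : ℂ => herm (p (z + s • ξ)) (fderiv ℂ p z ξ))
        (herm (fderiv ℂ p z ξ) (fderiv ℂ p z ξ)) 0 :=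
      HasDerivAt.fun_sum fun l _ => (hasDerivAt_pi.1 hd1 l).mul_const _
    have hd3 := (hasDerivAt_const (0 : ℂ) (0 : ℂ)).congr_of_eventuallyEq ev2
    exact herm_self_eq_zero.1 (hd2.unique hd3)
  obtain ⟨z₀, hz₀⟩ := hne
  have dense : Dense {y : Cn1 n | p y.1 ≠ 0 ∧ y.2 ≠ 0} := by
    obtain ⟨l, hl⟩ := Function.ne_iff.1 hz₀
    have ha : AnalyticOnNhd ℂ (fun y : Cn1 n => p y.1 l * y.2) Set.univ := fun y _ =>
      ((analyticAt_pi_iff.1 ((hp y.1 trivial).comp analyticAt_fst)) l).mul analyticAt_snd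
    intro y
    by_contra hy
    rw [mem_closure_iff_frequently, not_frequently] at hy
    have h0 : (fun y : Cn1 n => p y.1 l * y.2) =ᶠ[𝓝 y] 0 := by
      filter_upwards [hy] with v hv
      by_contra hv0
      simp only [Pi.zero_apply, mul_eq_zero, not_or] at hv0
      exact hv ⟨fun h => hv0.1 (by simp [h]), hv0.2⟩
    have := ha.eqOn_zero_of_preconnected_of_eventuallyEq_zero isPreconnected_univ trivial h0
      (Set.mem_univ (z₀, 1))
    exact hl (by simpa using this)
  have cf : Continuous fun y : Cn1 n => fderiv ℂ p y.1 (f y) := by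
    have c1 : Continuous fun y : Cn1 n => fderiv ℂ p y.1 :=
      (continuous_iff_continuousAt.2 fun z => (hp.fderiv z trivial).continuousAt).comp continuous_fst
    exact c1.clm_apply hf.continuous
  constructor
  · exact congrFun (hg.continuous.ext_on dense continuous_const fun y hy => gz y.1 y.2 hy.1 hy.2) x
  · exact congrFun (cf.ext_on dense continuous_const fun y hy => fz y.1 y.2 hy.1 hy.2) x

end Algebra

/-! ### Flatness from vanishing derivatives -/

section Flat

variable {𝕜 : Type} [RCLike 𝕜]

/-- A smooth map whose derivatives of order less than `k` vanish at the origin is `O(‖x‖ᵏ)`. -/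
theorem isBigO_pow_of_iteratedFDeriv_eq_zero {E : Type} [NormedAddCommGroup E] [NormedSpace 𝕜 E]
    [NormedSpace ℝ E] (k : ℕ) :
    -- The target is quantified inside the induction, since the inductive hypothesis is applied to
    -- `fderiv 𝕜 r`, valued in linear maps.
    ∀ {F : Type} [NormedAddCommGroup F] [NormedSpace 𝕜 F] {r : E → F}, ContDiffAt 𝕜 ∞ r 0 →
      (∀ i < k, iteratedFDeriv 𝕜 i r 0 = 0) → r =O[𝓝 0] fun x => ‖x‖ ^ k := by
  induction k with
  | zero =>
    intro F _ _ r hr _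
    simpa using hr.continuousAt.isBigO_one ℝ
  | succ k ih =>
    intro F _ _ r hr h
    have hr' : ContDiffAt 𝕜 ∞ (fderiv 𝕜 r) 0 := hr.fderiv_right le_rfl
    have h1 := ih hr' fun i hi => by
      rw [← norm_eq_zero, norm_iteratedFDeriv_fderiv, h (i + 1) (by omega), norm_zero]
    obtain ⟨C, hC⟩ := h1.bound
    have hdiff : ∀ᶠ x in 𝓝 (0 : E), DifferentiableAt 𝕜 r x := by
      filter_upwards [(hr.of_le (m := 1) (by simp)).eventually (by simp)] with x hx
      exact hx.differentiableAt (by simp)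
    obtain ⟨ε, hε, hball⟩ := Metric.eventually_nhds_iff_ball.1 (hC.and hdiff)
    refine Asymptotics.IsBigO.of_bound C ?_
    filter_upwards [Metric.ball_mem_nhds (0 : E) hε] with x hx
    have hsub : ∀ y ∈ Metric.closedBall (0 : E) ‖x‖, y ∈ Metric.ball (0 : E) ε := fun y hy => by
      simp only [mem_ball_zero_iff, mem_closedBall_zero_iff] at *
      exact hy.trans_lt hx
    have hr0 : r 0 = 0 := by
      have := h 0 (by omega)
      rw [← norm_eq_zero, norm_iteratedFDeriv_zero] at this
      exact norm_eq_zero.1 this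
    have hCnn : 0 ≤ C ∨ x = 0 := by
      by_cases hx0 : x = 0
      · exact Or.inr hx0
      left
      have h2 := (hball x hx).1
      have h3 : 0 < ‖‖x‖ ^ k‖ := by
        rw [norm_pow, norm_norm]; exact pow_pos (norm_pos_iff.2 hx0) k
      by_contra hneg
      have h4 := norm_nonneg (fderiv 𝕜 r x)
      nlinarith
    rcases hCnn with hCnn | rfl
    · have := Convex.norm_image_sub_le_of_norm_fderiv_le (𝕜 := 𝕜) (f := r) (C := C * ‖x‖ ^ k)
        (s := Metric.closedBall (0 : E) ‖x‖) (x := 0) (y := x)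
        (fun y hy => (hball y (hsub y hy)).2)
        (fun y hy => by
          refine (hball y (hsub y hy)).1.trans ?_
          rw [norm_pow, norm_norm]
          simp only [mem_closedBall_zero_iff] at hy
          gcongr)
        (convex_closedBall _ _) (by simp) (by simp)
      rw [hr0, sub_zero, sub_zero] at this
      rwa [norm_pow, norm_norm, pow_succ, ← mul_assoc]
    · simp [hr0]

end Flat

/-! ### Estimates for the perturbation term -/

variable {n k d : ℕ}

lemma WeightedDerivativesVanish.iteratedFDeriv_comp_inl {m : ℕ} (hm : 0 < m)
    {r : (Fin n → ℂ) × ℝ → ℝ} (hr : ContDiffAt ℝ ∞ r 0) (hW : WeightedDerivativesVanish m r)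
    {j : ℕ} (hj : j ≤ m) :
    iteratedFDeriv ℝ j (fun z : Fin n → ℂ => r (z, 0)) 0 = 0 := by
  obtain ⟨U, hU, hrU⟩ := hr.contDiffOn (m := j) (by exact_mod_cast le_top) (by simp)
  obtain ⟨t, htU, hto, h0t⟩ := mem_nhds_iff.1 (by simpa using hU : U ∈ 𝓝 (0 : (Fin n → ℂ) × ℝ))
  have hrt : ContDiffOn ℝ j r t := hrU.mono (by simpa using htU)
  set L : (Fin n → ℂ) →L[ℝ] (Fin n → ℂ) × ℝ := ContinuousLinearMap.inl ℝ _ _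
  have hpre : IsOpen (L ⁻¹' t) := hto.preimage L.continuous
  have hL0 : L 0 = 0 := map_zero L
  have h := ContinuousLinearMap.iteratedFDerivWithin_comp_right L hrt hto.uniqueDiffOn
    hpre.uniqueDiffOn (x := 0) (by rwa [hL0]) (i := j) le_rfl
  rw [iteratedFDerivWithin_of_isOpen j hpre (by simpa [hL0] using h0t),
    iteratedFDerivWithin_of_isOpen j hto (by simpa [hL0] using h0t), hL0] at h
  have hrL : (fun z : Fin n → ℂ => r (z, 0)) = r ∘ L := rfl
  rw [hrL, h]
  ext v
  have hq : ((0 : ℕ) : ℚ) + (j : ℚ) / (m : ℚ) ≤ 1 := by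
    rw [Nat.cast_zero, zero_add, div_le_one (by exact_mod_cast hm)]
    exact_mod_cast hj
  have := hW j 0 hq v
  have happ : (Fin.append (fun i => ((v i, 0) : (Fin n → ℂ) × ℝ)) (fun _ : Fin 0 => (0, 1))) =
      fun i => L (v i) := by
    ext i : 1
    exact Fin.append_left (fun i => ((v i, 0) : (Fin n → ℂ) × ℝ)) (fun _ : Fin 0 => (0, 1)) i
  rw [happ] at this
  exact this

lemma WeightedDerivativesVanish.fderiv_inr {m : ℕ}
    {r : (Fin n → ℂ) × ℝ → ℝ} (hW : WeightedDerivativesVanish m r) :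
    fderiv ℝ r 0 (0, 1) = 0 := by
  have := hW 0 1 (by simp) Fin.elim0
  rw [← this]
  have h1 : ∀ v : Fin (0 + 1) → (Fin n → ℂ) × ℝ,
      iteratedFDeriv ℝ (0 + 1) r 0 v = fderiv ℝ r 0 (v 0) := fun v => iteratedFDeriv_one_apply v
  rw [h1]
  congr 1

/-- The Lipschitz estimate for a smooth perturbation term of weighted order greater than one. -/
theorem WeightedDerivativesVanish.exists_lipschitz {m : ℕ} (hm : 0 < m)
    {r : (Fin n → ℂ) × ℝ → ℝ} (hr : ContDiffAt ℝ ∞ r 0) (hW : WeightedDerivativesVanish m r) :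
    ∃ C > 0, ∃ ε > 0, ∀ a b : ℝ, a < ε → b < ε → ∀ (z z' : Fin n → ℂ) (u u' : ℝ),
      ‖z‖ ≤ a → ‖z'‖ ≤ a → |u| ≤ b → |u'| ≤ b →
      |r (z, u) - r (z', u')| ≤ C * ((a ^ m + b) * ‖z - z'‖ + (a + b) * |u - u'|) := by
  have hr' : ContDiffAt ℝ ∞ (fderiv ℝ r) 0 := hr.fderiv_right le_rfl
  obtain ⟨K, t, ht, hK⟩ := (hr'.of_le (m := 1) (by simp)).exists_lipschitzOnWith
  have hdiff : ∀ᶠ x in 𝓝 (0 : (Fin n → ℂ) × ℝ), DifferentiableAt ℝ r x := by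
    filter_upwards [(hr.of_le (m := 1) (by simp)).eventually (by simp)] with x hx
    exact hx.differentiableAt (by simp)
  obtain ⟨ε₁, hε₁, hb₁⟩ := Metric.eventually_nhds_iff_ball.1 (hdiff.and ht)
  have hr0 : ContDiffAt ℝ ∞ (fun z : Fin n → ℂ => r (z, 0)) 0 :=
    ContDiffAt.comp (0 : Fin n → ℂ) (g := r) (f := fun z => (z, (0 : ℝ))) hr
      (contDiffAt_id.prodMk contDiffAt_const)
  -- Pure `z`-derivatives vanish up to order `m` inclusive, so the `z`-gradient on `u = 0` is of
  -- order `m`, not just `m - 1`. Moving off `u = 0` costs `K * b`.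
  have hflat : fderiv ℝ (fun z : Fin n → ℂ => r (z, 0)) =O[𝓝 0] fun z => ‖z‖ ^ m := by
    refine isBigO_pow_of_iteratedFDeriv_eq_zero m (hr0.fderiv_right le_rfl) fun i hi => ?_
    rw [← norm_eq_zero, norm_iteratedFDeriv_fderiv,
      hW.iteratedFDeriv_comp_inl hm hr (by omega), norm_zero]
  obtain ⟨C₁, hC₁p, hC₁⟩ := hflat.exists_pos
  obtain ⟨ε₂, hε₂, hb₂⟩ := Metric.eventually_nhds_iff_ball.1 hC₁.bound
  refine ⟨C₁ + K, by positivity, min ε₁ ε₂, lt_min hε₁ hε₂, ?_⟩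
  intro a b ha hb z z' u u' hz hz' hu hu'
  have ha0 : 0 ≤ a := (norm_nonneg z).trans hz
  have hb0 : 0 ≤ b := (abs_nonneg u).trans hu
  have hmem : ∀ (y : Fin n → ℂ) (s : ℝ), ‖y‖ ≤ a → |s| ≤ b →
      ((y, s) : (Fin n → ℂ) × ℝ) ∈ Metric.ball (0 : (Fin n → ℂ) × ℝ) ε₁ := by
    intro y s hy hs
    rw [mem_ball_zero_iff, Prod.norm_mk, max_lt_iff]
    exact ⟨hy.trans_lt (ha.trans_le (min_le_left _ _)), hs.trans_lt (hb.trans_le (min_le_left _ _))⟩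
  have hlip : ∀ (y y' : Fin n → ℂ) (s s' : ℝ), ‖y‖ ≤ a → |s| ≤ b → ‖y'‖ ≤ a → |s'| ≤ b →
      ‖fderiv ℝ r (y, s) - fderiv ℝ r (y', s')‖ ≤ K * ‖((y, s) : (Fin n → ℂ) × ℝ) - (y', s')‖ :=
    fun y y' s s' hy hs hy' hs' => by
      simpa only [dist_eq_norm] using
        hK.dist_le_mul _ (hb₁ _ (hmem y s hy hs)).2 _ (hb₁ _ (hmem y' s' hy' hs')).2
  have hz1 : ∀ y : Fin n → ℂ, ‖y‖ ≤ a →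
      ‖(fderiv ℝ r (y, u)).comp (ContinuousLinearMap.inl ℝ (Fin n → ℂ) ℝ)‖ ≤ C₁ * a ^ m + K * b := by
    intro y hy
    have e1 : fderiv ℝ (fun z : Fin n → ℂ => r (z, 0)) y =
        (fderiv ℝ r (y, 0)).comp (ContinuousLinearMap.inl ℝ (Fin n → ℂ) ℝ) :=
      ((hb₁ _ (hmem y 0 hy (by simpa using hb0))).1.hasFDerivAt.comp y
        (hasFDerivAt_prodMk_left y (0 : ℝ))).fderiv
    have e2 : ‖fderiv ℝ (fun z : Fin n → ℂ => r (z, 0)) y‖ ≤ C₁ * a ^ m := by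
      refine (hb₂ y ?_).trans ?_
      · rw [mem_ball_zero_iff]
        exact hy.trans_lt (ha.trans_le (min_le_right _ _))
      · rw [norm_pow, norm_norm]
        gcongr
    have e3 : (fderiv ℝ r (y, u)).comp (ContinuousLinearMap.inl ℝ (Fin n → ℂ) ℝ) =
        fderiv ℝ (fun z : Fin n → ℂ => r (z, 0)) y +
        (fderiv ℝ r (y, u) - fderiv ℝ r (y, 0)).comp
          (ContinuousLinearMap.inl ℝ (Fin n → ℂ) ℝ) := by
      rw [e1, ContinuousLinearMap.sub_comp]; abel
    rw [e3]
    refine (norm_add_le _ _).trans (add_le_add e2 ?_)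
    refine (ContinuousLinearMap.opNorm_comp_le _ _).trans ?_
    have e4 := hlip y y u 0 hy hu hy (by simpa using hb0)
    rw [Prod.mk_sub_mk, sub_self, sub_zero, Prod.norm_mk, norm_zero,
      max_eq_right (norm_nonneg _), Real.norm_eq_abs] at e4
    calc _ ≤ (K * |u|) * 1 := by
          gcongr
          exact ContinuousLinearMap.norm_inl_le_one ℝ _ _
      _ ≤ K * b := by rw [mul_one]; gcongr
  -- The `u`-derivative has weighted order exactly one, so it vanishes at 0 and is bounded by its
  -- Lipschitz growth.
  have hu1 : ∀ s : ℝ, |s| ≤ b →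
      ‖(fderiv ℝ r (z', s)).comp (ContinuousLinearMap.inr ℝ (Fin n → ℂ) ℝ)‖ ≤ K * (a + b) := by
    intro s hs
    have e1 : (fderiv ℝ r 0).comp (ContinuousLinearMap.inr ℝ (Fin n → ℂ) ℝ) = 0 := by
      ext
      simpa using hW.fderiv_inr
    have e2 : (fderiv ℝ r (z', s)).comp (ContinuousLinearMap.inr ℝ (Fin n → ℂ) ℝ) =
        (fderiv ℝ r (z', s) - fderiv ℝ r (0, 0)).comp
          (ContinuousLinearMap.inr ℝ (Fin n → ℂ) ℝ) := by
      rw [ContinuousLinearMap.sub_comp]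
      change _ = _ - (fderiv ℝ r 0).comp _
      rw [e1, sub_zero]
    rw [e2]
    refine (ContinuousLinearMap.opNorm_comp_le _ _).trans ?_
    have e4 := hlip z' 0 s 0 hz' hs (by simpa using ha0) (by simpa using hb0)
    rw [Prod.mk_sub_mk, sub_zero, sub_zero, Prod.norm_mk, Real.norm_eq_abs] at e4
    calc _ ≤ (K * max ‖z'‖ |s|) * 1 := by
          gcongr
          exact ContinuousLinearMap.norm_inr_le_one ℝ _ _
      _ ≤ K * (a + b) := by
          rw [mul_one]
          gcongr
          exact max_le (by linarith) (by linarith)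
  have m1 : ‖r (z, u) - r (z', u)‖ ≤ (C₁ * a ^ m + K * b) * ‖z - z'‖ :=
    Convex.norm_image_sub_le_of_norm_hasFDerivWithin_le (𝕜 := ℝ) (f := fun y => r (y, u))
      (f' := fun y => (fderiv ℝ r (y, u)).comp (ContinuousLinearMap.inl ℝ (Fin n → ℂ) ℝ))
      (s := Metric.closedBall 0 a)
      (fun y hy => ((hb₁ _ (hmem y u (by simpa using hy) hu)).1.hasFDerivAt.comp y
        (hasFDerivAt_prodMk_left y u)).hasFDerivWithinAt)
      (fun y hy => hz1 y (by simpa using hy)) (convex_closedBall _ _) (by simpa using hz')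
      (by simpa using hz)
  have m2 : ‖r (z', u) - r (z', u')‖ ≤ (K * (a + b)) * ‖u - u'‖ :=
    Convex.norm_image_sub_le_of_norm_hasFDerivWithin_le (𝕜 := ℝ) (f := fun s => r (z', s))
      (f' := fun s => (fderiv ℝ r (z', s)).comp (ContinuousLinearMap.inr ℝ (Fin n → ℂ) ℝ))
      (s := Metric.closedBall 0 b)
      (fun s hs => ((hb₁ _ (hmem z' s hz' (by simpa using hs))).1.hasFDerivAt.comp s
        (hasFDerivAt_prodMk_right z' s)).hasFDerivWithinAt)
      (fun s hs => hu1 s (by simpa using hs)) (convex_closedBall _ _) (by simpa using hu')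
      (by simpa using hu)
  rw [Real.norm_eq_abs] at m1 m2
  rw [Real.norm_eq_abs] at m2
  have hK0 : (0 : ℝ) ≤ K := K.2
  calc |r (z, u) - r (z', u')| ≤ |r (z, u) - r (z', u)| + |r (z', u) - r (z', u')| :=
        abs_sub_le _ _ _
    _ ≤ (C₁ * a ^ m + K * b) * ‖z - z'‖ + (K * (a + b)) * |u - u'| := add_le_add m1 m2
    _ ≤ (C₁ + K) * ((a ^ m + b) * ‖z - z'‖ + (a + b) * |u - u'|) := by
        have p1 : 0 ≤ K * a ^ m * ‖z - z'‖ := by positivity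
        have p2 : 0 ≤ C₁ * b * ‖z - z'‖ := by positivity
        have p3 : 0 ≤ C₁ * ((a + b) * |u - u'|) := by positivity
        linarith

/-! ### Taylor expansion in a parameter -/

section Expansion

variable {E F : Type} [NormedAddCommGroup E] [NormedSpace ℂ E] [NormedAddCommGroup F]
  [NormedSpace ℂ F]

/-- The partial derivative in the first variable of a map on `ℂ × E`. -/
noncomputable def paramDeriv (Φ : ℂ × E → F) : ℂ × E → F := fun x => fderiv ℂ Φ x (1, 0)

lemma analyticAt_paramDeriv_iterate [CompleteSpace F] {Φ : ℂ × E → F} {x : ℂ × E}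
    (h : AnalyticAt ℂ Φ x) (j : ℕ) : AnalyticAt ℂ (paramDeriv^[j] Φ) x := by
  induction j generalizing Φ with
  | zero => exact h
  | succ j ih =>
    exact ih (((ContinuousLinearMap.apply ℂ F ((1, 0) : ℂ × E)).analyticAt _).comp h.fderiv)

lemma hasDerivAt_paramDeriv {Φ : ℂ × E → F} {t : ℂ} {y : E} (h : AnalyticAt ℂ Φ (t, y)) :
    HasDerivAt (fun s => Φ (s, y)) (paramDeriv Φ (t, y)) t :=
  h.differentiableAt.hasFDerivAt.comp_hasDerivAt t ((hasDerivAt_id t).prodMk (hasDerivAt_const t y))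

lemma iteratedDeriv_eq_paramDeriv_iterate [CompleteSpace F] {Φ : ℂ × E → F} {t : ℂ} {y : E}
    (h : AnalyticAt ℂ Φ (t, y)) (j : ℕ) :
    iteratedDeriv j (fun s => Φ (s, y)) t = paramDeriv^[j] Φ (t, y) := by
  induction j generalizing Φ with
  | zero => simp
  | succ j ih =>
    rw [iteratedDeriv_succ', Function.iterate_succ_apply,
      ← ih (Φ := paramDeriv Φ) (analyticAt_paramDeriv_iterate h 1)]
    refine Filter.EventuallyEq.iteratedDeriv_eq j ?_
    have hc : ContinuousAt (fun s : ℂ => (s, y)) t := by fun_prop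
    filter_upwards [hc.eventually h.eventually_analyticAt] with s hs
    exact (hasDerivAt_paramDeriv hs).deriv

/-- Taylor expansion in the parameter to leading order, locally uniformly in the second variable. -/
theorem exists_norm_sub_leading_term_le [CompleteSpace F] (N : ℕ) (y₀ : E) :
    ∀ {Φ : ℂ × E → F}, AnalyticAt ℂ Φ (0, y₀) →
      (∀ j < N, ∀ y, paramDeriv^[j] Φ (0, y) = 0) →
      ∃ C : ℝ, 0 ≤ C ∧ ∀ᶠ x in 𝓝 ((0 : ℂ), y₀),
        ‖Φ x - x.1 ^ N • ((N.factorial : ℂ)⁻¹ • paramDeriv^[N] Φ (0, x.2))‖ ≤ C * ‖x.1‖ ^ (N + 1) := by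
  induction N with
  | zero =>
    intro Φ h _
    obtain ⟨K, t, ht, hK⟩ := (h.contDiffAt (n := 1)).exists_lipschitzOnWith
    refine ⟨K, K.2, ?_⟩
    have hc : ContinuousAt (fun x : ℂ × E => ((0 : ℂ), x.2)) (0, y₀) := by fun_prop
    filter_upwards [ht, hc.eventually (p := fun v => v ∈ t) ht] with x hx hx0
    have := hK.dist_le_mul _ hx _ hx0
    rw [dist_eq_norm, dist_eq_norm] at this
    have hxx : ‖x - (0, x.2)‖ = ‖x.1‖ := by
      rw [Prod.norm_def]; simp
    rw [hxx] at this
    simpa using this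
  | succ N ih =>
    intro Φ h hz
    obtain ⟨C, hC0, hC⟩ := ih (Φ := paramDeriv Φ) (analyticAt_paramDeriv_iterate h 1)
      fun j hj y => hz (j + 1) (by omega) y
    refine ⟨C, hC0, ?_⟩
    have hev := hC.and h.eventually_analyticAt
    rw [nhds_prod_eq, eventually_prod_iff] at hev
    obtain ⟨pa, hpa, pb, hpb, hab⟩ := hev
    obtain ⟨ε, hε, hball⟩ := Metric.eventually_nhds_iff_ball.1 hpa
    rw [nhds_prod_eq]
    refine ((Metric.eventually_nhds_iff_ball.2 ⟨ε, hε, fun y hy => hy⟩).prod_mk hpb).mono ?_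
    rintro ⟨t, y⟩ ⟨ht, hy⟩
    set c := paramDeriv^[N + 1] Φ (0, y) with hc
    -- The derivative of the order `N + 1` remainder of `Φ` is the order `N` remainder of
    -- `paramDeriv Φ`; the mean value inequality gains one power of `‖t‖`.
    have hder : ∀ s ∈ Metric.closedBall (0 : ℂ) ‖t‖,
        HasDerivWithinAt (fun s => Φ (s, y) - s ^ (N + 1) • (((N + 1).factorial : ℂ)⁻¹ • c))
          (paramDeriv Φ (s, y) - s ^ N • ((N.factorial : ℂ)⁻¹ • c))
          (Metric.closedBall (0 : ℂ) ‖t‖) s := by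
      intro s hs
      have hs' : s ∈ Metric.ball (0 : ℂ) ε := by
        simp only [mem_ball_zero_iff, mem_closedBall_zero_iff] at *
        exact hs.trans_lt ht
      have h1 := hasDerivAt_paramDeriv (hab (hball s hs') hy).2
      have h2 := (hasDerivAt_pow (N + 1) s).smul_const (((N + 1).factorial : ℂ)⁻¹ • c)
      have h3 : (((N + 1 : ℕ) : ℂ) * s ^ (N + 1 - 1)) • (((N + 1).factorial : ℂ)⁻¹ • c) =
          s ^ N • ((N.factorial : ℂ)⁻¹ • c) := by
        rw [smul_smul, smul_smul]
        congr 1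
        have : (N.factorial : ℂ) ≠ 0 := by exact_mod_cast N.factorial_ne_zero
        have h4 : (N : ℂ) + 1 ≠ 0 := by exact_mod_cast N.succ_ne_zero
        rw [Nat.factorial_succ]
        push_cast
        field_simp
      rw [h3] at h2
      exact (h1.sub h2).hasDerivWithinAt
    have hbd : ∀ s ∈ Metric.closedBall (0 : ℂ) ‖t‖,
        ‖paramDeriv Φ (s, y) - s ^ N • ((N.factorial : ℂ)⁻¹ • c)‖ ≤ C * ‖t‖ ^ (N + 1) := by
      intro s hs
      simp only [mem_closedBall_zero_iff] at hs
      have hs' : s ∈ Metric.ball (0 : ℂ) ε := by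
        simp only [mem_ball_zero_iff] at *
        exact hs.trans_lt ht
      refine ((hab (hball s hs') hy).1).trans ?_
      dsimp only
      gcongr
    have := Convex.norm_image_sub_le_of_norm_hasDerivWithin_le hder hbd (convex_closedBall _ _)
      (x := 0) (y := t) (by simp) (by simp)
    have h00 : Φ (0, y) = 0 := hz 0 (by omega) y
    simp only [h00, ne_eq, Nat.add_eq_zero_iff, one_ne_zero, and_false, not_false_eq_true, zero_pow,
      zero_smul, sub_zero] at this
    refine this.trans (le_of_eq ?_)
    ring

lemma eventually_eq_zero_of_iteratedDeriv_eq_zero [CompleteSpace F] {φ : ℂ → F} {t : ℂ}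
    (hφ : AnalyticAt ℂ φ t) (h : ∀ j, iteratedDeriv j φ t = 0) : ∀ᶠ s in 𝓝 t, φ s = 0 := by
  rw [← analyticOrderAt_eq_top]
  refine ENat.eq_top_iff_forall_ge.2 fun j => ?_
  rw [natCast_le_analyticOrderAt_iff_iteratedDeriv_eq_zero hφ]
  exact fun i _ => h i

end Expansion

/-! ### Weighted homogeneous components of a field -/

section Weighted

/-- The weighted dilation `(z, w) ↦ (t z, tᵐ w)`. -/
def dil (m : ℕ) (t : ℂ) (x : Cn1 n) : Cn1 n := (t • x.1, t ^ m * x.2)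

/-- The family `t^{m-1} · (dil t)^* K`, whose Taylor coefficients in `t` are the weighted
homogeneous components of the field `K`. -/
def weightedFamily (m : ℕ) (K : Cn1 n → Cn1 n) (x : ℂ × Cn1 n) : Cn1 n :=
  (x.1 ^ (m - 1) • (K (dil m x.1 x.2)).1, (K (dil m x.1 x.2)).2)

/-- The component of order `j` of `K` in the weighted expansion. -/
noncomputable def weightedComponent (m j : ℕ) (K : Cn1 n → Cn1 n) (x : Cn1 n) : Cn1 n :=
  ((j.factorial : ℂ))⁻¹ • paramDeriv^[j] (weightedFamily m K) (0, x)

lemma norm_dil_le {m : ℕ} (hm : 0 < m) {t : ℂ} (ht : ‖t‖ ≤ 1) (x : Cn1 n) :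
    ‖dil m t x‖ ≤ ‖t‖ * ‖x‖ := by
  rw [dil, Prod.norm_mk, norm_smul, norm_mul, norm_pow]
  refine max_le (by gcongr; exact norm_fst_le x) ?_
  have : ‖t‖ ^ m ≤ ‖t‖ := pow_le_of_le_one (norm_nonneg _) ht hm.ne'
  exact mul_le_mul this (norm_snd_le x) (norm_nonneg _) (norm_nonneg _)

lemma analyticAt_weightedFamily {m : ℕ} {K : Cn1 n → Cn1 n} {x : ℂ × Cn1 n}
    (hK : AnalyticAt ℂ K (dil m x.1 x.2)) : AnalyticAt ℂ (weightedFamily m K) x := by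
  have ht : AnalyticAt ℂ (fun x : ℂ × Cn1 n => x.1) x := analyticAt_fst
  have hy : AnalyticAt ℂ (fun x : ℂ × Cn1 n => x.2) x := analyticAt_snd
  have h1 : AnalyticAt ℂ (fun x : ℂ × Cn1 n => dil m x.1 x.2) x :=
    (ht.smul (analyticAt_fst.comp hy)).prod ((ht.pow m).mul (analyticAt_snd.comp hy))
  have h2 : AnalyticAt ℂ (fun x : ℂ × Cn1 n => K (dil m x.1 x.2)) x :=
    AnalyticAt.comp (g := K) (f := fun x : ℂ × Cn1 n => dil m x.1 x.2) hK h1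
  exact ((ht.pow (m - 1)).smul (analyticAt_fst.comp h2)).prod (analyticAt_snd.comp h2)

lemma dil_zero {m : ℕ} (hm : 0 < m) (x : Cn1 n) : dil m 0 x = 0 := by
  simp [dil, hm.ne']

lemma analyticAt_weightedFamily_zero {m : ℕ} (hm : 0 < m) {K : Cn1 n → Cn1 n}
    (hK : AnalyticAt ℂ K 0) (x : Cn1 n) : AnalyticAt ℂ (weightedFamily m K) (0, x) :=
  analyticAt_weightedFamily (by simpa [dil_zero hm] using hK)

/-- At `t = 0` the dilation sends every `x` to 0, so analyticity of `K` at 0 alone makes the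
components entire. -/
lemma analyticAt_weightedComponent {m : ℕ} (hm : 0 < m) {K : Cn1 n → Cn1 n}
    (hK : AnalyticAt ℂ K 0) (j : ℕ) (x : Cn1 n) : AnalyticAt ℂ (weightedComponent m j K) x := by
  have h1 : AnalyticAt ℂ (fun x : Cn1 n => ((0 : ℂ), x)) x := by fun_prop
  have h2 := (analyticAt_paramDeriv_iterate (analyticAt_weightedFamily_zero hm hK x) j).comp h1
  exact (analyticAt_const (v := ((j.factorial : ℂ))⁻¹)).smul h2

lemma norm_weightedFamily_le {m : ℕ} {K : Cn1 n → Cn1 n} {t : ℂ} (ht : ‖t‖ ≤ 1)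
    (x : Cn1 n) : ‖weightedFamily m K (t, x)‖ ≤ ‖K (dil m t x)‖ := by
  rw [weightedFamily, Prod.norm_mk, norm_smul, norm_pow]
  refine max_le ?_ (norm_snd_le _)
  calc ‖t‖ ^ (m - 1) * ‖(K (dil m t x)).1‖ ≤ 1 * ‖(K (dil m t x)).1‖ := by
        gcongr; exact pow_le_one₀ (norm_nonneg _) ht
    _ ≤ _ := by rw [one_mul]; exact norm_fst_le _

/-- Cauchy estimate: weighted components inherit the order of vanishing at the origin. -/
lemma weightedComponent_isBigO {m : ℕ} (hm : 0 < m) {K : Cn1 n → Cn1 n}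
    (hK : AnalyticAt ℂ K 0) (hK3 : K =O[𝓝 0] fun x => ‖x‖ ^ 3) (j : ℕ) :
    weightedComponent m j K =O[𝓝 0] fun x => ‖x‖ ^ 3 := by
  obtain ⟨C, hC0, hC⟩ := hK3.exists_pos
  obtain ⟨ε, hε, hb⟩ := Metric.eventually_nhds_iff_ball.1 (hC.bound.and hK.eventually_analyticAt)
  refine Asymptotics.IsBigO.of_bound C ?_
  filter_upwards [Metric.ball_mem_nhds (0 : Cn1 n) hε] with x hx
  have hdil : ∀ t : ℂ, ‖t‖ ≤ 1 → ‖dil m t x‖ ≤ ‖x‖ := fun t ht =>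
    (norm_dil_le hm ht x).trans (mul_le_of_le_one_left (norm_nonneg _) ht)
  have hmem : ∀ t : ℂ, ‖t‖ ≤ 1 → dil m t x ∈ Metric.ball (0 : Cn1 n) ε := fun t ht => by
    rw [mem_ball_zero_iff] at *
    exact (hdil t ht).trans_lt hx
  have hd : DiffContOnCl ℂ (fun t => weightedFamily m K (t, x)) (Metric.ball 0 1) := by
    apply DifferentiableOn.diffContOnCl
    rw [closure_ball _ one_ne_zero]
    intro t ht
    exact (hasDerivAt_paramDeriv (analyticAt_weightedFamily
      (hb _ (hmem t (by simpa using ht))).2)).differentiableAt.differentiableWithinAt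
  have hle := Complex.norm_iteratedDeriv_le_of_forall_mem_sphere_norm_le (C := C * ‖x‖ ^ 3) j
    one_pos hd (fun t ht => by
      have ht' : ‖t‖ ≤ 1 := by simpa using le_of_eq (mem_sphere_zero_iff_norm.1 ht)
      refine (norm_weightedFamily_le ht' x).trans ((hb _ (hmem t ht')).1.trans ?_)
      rw [norm_pow, norm_norm]
      gcongr
      exact hdil t ht')
  rw [iteratedDeriv_eq_paramDeriv_iterate (analyticAt_weightedFamily_zero hm hK x), one_pow,
    div_one] at hle
  have hfac : (0 : ℝ) < j.factorial := by exact_mod_cast j.factorial_pos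
  rw [weightedComponent, norm_smul, norm_inv, Complex.norm_natCast, norm_pow, norm_norm,
    inv_mul_le_iff₀ hfac]
  exact hle

/-- An analytic germ all of whose weighted components vanish is zero. -/
lemma eventually_eq_zero_of_weightedComponent {m : ℕ} (hm : 0 < m) {K : Cn1 n → Cn1 n}
    (hK : AnalyticAt ℂ K 0) (h : ∀ j, weightedComponent m j K = 0) : ∀ᶠ x in 𝓝 0, K x = 0 := by
  obtain ⟨ε, hε, hb⟩ := Metric.eventually_nhds_iff_ball.1 hK.eventually_analyticAt
  -- The `t`-disc of radius 1 keeps `dil m t x` in the ball of analyticity. The value `t = 1/2` is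
  -- interior to it and nonzero, and `dil m 2` undoes the dilation.
  have key : ∀ x ∈ Metric.ball (0 : Cn1 n) ε, K (dil m 2⁻¹ x) = 0 := by
    intro x hx
    have ha : AnalyticOnNhd ℂ (fun t => weightedFamily m K (t, x)) (Metric.ball 0 1) := by
      intro t ht
      have h1 : AnalyticAt ℂ (fun t : ℂ => (t, x)) t := by fun_prop
      refine AnalyticAt.comp (g := weightedFamily m K) (analyticAt_weightedFamily (hb _ ?_)) h1
      rw [mem_ball_zero_iff] at *
      exact ((norm_dil_le hm ht.le x).trans (mul_le_of_le_one_left (norm_nonneg _) ht.le)).trans_lt hx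
    have hz := eventually_eq_zero_of_iteratedDeriv_eq_zero (ha 0 (by simp)) fun j => by
      rw [iteratedDeriv_eq_paramDeriv_iterate (analyticAt_weightedFamily_zero hm hK x)]
      have h2 := congrFun (h j) x
      have hfac : (j.factorial : ℂ) ≠ 0 := by exact_mod_cast j.factorial_ne_zero
      simpa [weightedComponent, hfac] using h2
    have h3 := ha.eqOn_zero_of_preconnected_of_eventuallyEq_zero
      (convex_ball _ _).isPreconnected (by simp) hz (show (2⁻¹ : ℂ) ∈ Metric.ball (0 : ℂ) 1 by
        rw [mem_ball_zero_iff, norm_inv, Complex.norm_ofNat]; norm_num)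
    have h4 := Prod.ext_iff.1 h3
    simp only [weightedFamily, Pi.zero_apply, Prod.fst_zero, Prod.snd_zero, smul_eq_zero] at h4
    exact Prod.ext (h4.1.resolve_left (by simp)) h4.2
  have hc : Continuous fun x : Cn1 n => dil m 2 x := by unfold dil; fun_prop
  have hc0 : Tendsto (fun x : Cn1 n => dil m 2 x) (𝓝 0) (𝓝 0) := hc.tendsto' 0 0 (by simp [dil])
  filter_upwards [hc0.eventually (Metric.ball_mem_nhds 0 hε)] with x hx
  have := key _ hx
  have hid : dil m 2⁻¹ (dil m 2 x) = x := by
    apply Prod.ext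
    · simp [dil, smul_smul]
    · simp only [dil]
      rw [← mul_assoc, ← mul_pow]
      simp
  rwa [hid] at this

end Weighted

/-! ### The leading component is tangent to the model -/

/-- If `id + K` preserves the hypersurface `Im w = ψ(z, Re w)`, where `ψ` is a perturbation of the
homogeneous function `Q`, then the leading weighted component of `K` is an infinitesimal
automorphism of the model `Im w = Q(z)`. -/
theorem tangency_of_leading_component {m N : ℕ} (hm : 2 ≤ m) {Q : (Fin n → ℂ) → ℝ}
    (hQd : Differentiable ℝ Q) (hQhom : ∀ t : ℝ, 0 < t → ∀ z, Q (t • z) = t ^ m * Q z)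
    {r : (Fin n → ℂ) × ℝ → ℝ} (hr : ContDiffAt ℝ ∞ r 0)
    (hW : WeightedDerivativesVanish m r) (hr0 : r 0 = 0) {K : Cn1 n → Cn1 n}
    (hK : AnalyticAt ℂ K 0) (hK3 : K =O[𝓝 0] fun x => ‖x‖ ^ 3)
    (hinv : ∀ᶠ x : (Fin n → ℂ) × ℝ in 𝓝 0, ∀ y : Cn1 n,
      y = (x.1, x.2 + I * (Q x.1 + r x : ℝ)) →
      Q x.1 + r x + (K y).2.im =
        Q (x.1 + (K y).1) + r (x.1 + (K y).1, x.2 + (K y).2.re))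
    (hN : ∀ j < N, weightedComponent m j K = 0) (z : Fin n → ℂ) (u : ℝ) :
    (weightedComponent m N K (z, u + I * Q z)).2.im =
      fderiv ℝ Q z (weightedComponent m N K (z, u + I * Q z)).1 := by
  obtain ⟨C, hC0, ε, hε, hlip⟩ := hW.exists_lipschitz (by omega) hr
  set Y := weightedComponent m N K
  set p₀ : Cn1 n := (z, u + I * Q z) with hp₀
  set x : ℝ → (Fin n → ℂ) × ℝ := fun t => (t • z, t ^ m * u) with hx
  -- Chosen so that `dil m t (y t)` is the point of `M` over `x t`; it tends to the model point `p₀`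
  -- because `r (x t)` is `o(t ^ m)`.
  set y : ℝ → Cn1 n := fun t => (z, u + I * (Q z + r (x t) / t ^ m : ℝ)) with hy
  set k : ℝ → Cn1 n := fun t => K (dil m t (y t)) with hk
  have ht0 : Tendsto (fun t : ℝ => t) (𝓝[>] 0) (𝓝 0) := tendsto_id.mono_left nhdsWithin_le_nhds
  have htpos : ∀ᶠ t : ℝ in 𝓝[>] 0, 0 < t := self_mem_nhdsWithin
  have ht1 : ∀ᶠ t : ℝ in 𝓝[>] 0, t ≤ 1 := ht0.eventually (eventually_le_nhds one_pos)
  have hcont : ∀ {φ : ℝ → ℝ}, Continuous φ → φ 0 = 0 → Tendsto φ (𝓝[>] 0) (𝓝 0) :=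
    fun hφ h0 => (hφ.tendsto' 0 0 h0).mono_left nhdsWithin_le_nhds
  have hx0 : Tendsto x (𝓝[>] 0) (𝓝 0) := by
    have hc : Continuous x := by fun_prop
    refine (hc.tendsto' 0 0 ?_).mono_left nhdsWithin_le_nhds
    simp [hx, show m ≠ 0 by omega]
  have hxa : ∀ t : ℝ, 0 < t → ‖(x t).1‖ = t * ‖z‖ := fun t ht => by
    simp [hx, norm_smul, abs_of_pos ht]
  have hxb : ∀ t : ℝ, 0 < t → |(x t).2| = t ^ m * |u| := fun t ht => by
    simp [hx, abs_mul, abs_of_pos ht]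
  have hη : Tendsto (fun t => r (x t) / t ^ m) (𝓝[>] 0) (𝓝 0) := by
    have hb : Tendsto (fun t : ℝ => C * ((‖z‖ ^ m + |u|) * (t * ‖z‖) +
        (t * ‖z‖ + t ^ m * |u|) * |u|)) (𝓝[>] 0) (𝓝 0) :=
      hcont (by fun_prop) (by simp [show m ≠ 0 by omega])
    refine squeeze_zero_norm' ?_ hb
    have ha : ∀ᶠ t : ℝ in 𝓝[>] 0, t * ‖z‖ < ε :=
      (hcont (φ := fun t => t * ‖z‖) (by fun_prop) (by simp)).eventually (eventually_lt_nhds hε)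
    have hb' : ∀ᶠ t : ℝ in 𝓝[>] 0, t ^ m * |u| < ε :=
      (hcont (φ := fun t => t ^ m * |u|) (by fun_prop)
        (by simp [show m ≠ 0 by omega])).eventually (eventually_lt_nhds hε)
    filter_upwards [htpos, ha, hb'] with t ht ha hb'
    have h := hlip _ _ ha hb' (x t).1 0 (x t).2 0 (hxa t ht).le
      (by rw [norm_zero]; positivity) (hxb t ht).le (by rw [abs_zero]; positivity)
    have hr00 : r (0, 0) = 0 := hr0
    rw [hr00, sub_zero, sub_zero, sub_zero, hxa t ht, hxb t ht] at h
    have htm : 0 < t ^ m := by positivity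
    rw [Real.norm_eq_abs, abs_div, abs_of_pos htm, div_le_iff₀ htm]
    refine h.trans (le_of_eq ?_)
    ring
  have hylim : Tendsto y (𝓝[>] 0) (𝓝 p₀) := by
    have hc : Continuous fun s : ℝ => ((z, u + I * (Q z + s : ℝ)) : Cn1 n) := by fun_prop
    exact (hc.tendsto' 0 p₀ (by simp [hp₀])).comp hη
  have hdil : ∀ t : ℝ, 0 < t →
      dil m t (y t) = ((x t).1, ((x t).2 : ℂ) + I * (Q (x t).1 + r (x t) : ℝ)) := by
    intro t ht
    have htm : (t : ℂ) ^ m ≠ 0 := by simp [ht.ne']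
    simp only [dil, hy]
    refine Prod.ext ?_ ?_
    · simp [hx]
    · have : Q (x t).1 = t ^ m * Q z := hQhom t ht z
      rw [this]
      simp only [hx]
      push_cast
      field_simp
  have hdn : ∀ᶠ t : ℝ in 𝓝[>] 0, ‖dil m (t : ℂ) (y t)‖ ≤ t * ‖y t‖ := by
    filter_upwards [htpos, ht1] with t ht h1
    have := norm_dil_le (m := m) (by omega) (t := (t : ℂ))
      (by rwa [Complex.norm_real, Real.norm_eq_abs, abs_of_pos ht]) (y t)
    rwa [Complex.norm_real, Real.norm_eq_abs, abs_of_pos ht] at this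
  have hdil0 : Tendsto (fun t : ℝ => dil m (t : ℂ) (y t)) (𝓝[>] 0) (𝓝 0) := by
    have h1 := ht0.mul hylim.norm
    rw [zero_mul] at h1
    exact squeeze_zero_norm' hdn h1
  -- third order vanishing along the curve
  have hk1 : Tendsto (fun t => t⁻¹ * ‖k t‖) (𝓝[>] 0) (𝓝 0) := by
    obtain ⟨C₃, hC₃0, hC₃⟩ := hK3.exists_pos
    have hb : Tendsto (fun t : ℝ => C₃ * (t ^ 2 * ‖y t‖ ^ 3)) (𝓝[>] 0) (𝓝 0) := by
      have h1 := ((ht0.pow 2).mul (hylim.norm.pow 3)).const_mul C₃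
      simpa using h1
    refine squeeze_zero' (htpos.mono fun t ht => by positivity) ?_ hb
    filter_upwards [htpos, hdn, hdil0.eventually hC₃.bound] with t ht hd hb
    rw [norm_pow, norm_norm] at hb
    rw [inv_mul_le_iff₀ ht]
    calc ‖k t‖ ≤ C₃ * ‖dil m (t : ℂ) (y t)‖ ^ 3 := hb
      _ ≤ C₃ * (t * ‖y t‖) ^ 3 := by gcongr
      _ = _ := by ring
  have hk0 : Tendsto (fun t => ‖k t‖) (𝓝[>] 0) (𝓝 0) := by
    have h1 := ht0.mul hk1
    rw [zero_mul] at h1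
    refine h1.congr' ?_
    filter_upwards [htpos] with t ht
    field_simp
  have ha1 : Tendsto (fun t : ℝ => t⁻¹ • (k t).1) (𝓝[>] 0) (𝓝 0) := by
    refine squeeze_zero_norm' ?_ hk1
    filter_upwards [htpos] with t ht
    rw [norm_smul, norm_inv, Real.norm_eq_abs, abs_of_pos ht]
    gcongr
    exact norm_fst_le _
  have ha0 : Tendsto (fun t : ℝ => ‖(k t).1‖) (𝓝[>] 0) (𝓝 0) :=
    squeeze_zero (fun t => norm_nonneg _) (fun t => norm_fst_le _) hk0
  have hb0 : Tendsto (fun t : ℝ => ‖(k t).2‖) (𝓝[>] 0) (𝓝 0) :=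
    squeeze_zero (fun t => norm_nonneg _) (fun t => norm_snd_le _) hk0
  -- the leading term along the curve
  have hlead : Tendsto (fun t : ℝ => (t ^ N)⁻¹ • weightedFamily m K ((t : ℂ), y t)) (𝓝[>] 0)
      (𝓝 (Y p₀)) := by
    have hz : ∀ j < N, ∀ v, paramDeriv^[j] (weightedFamily m K) (0, v) = 0 := by
      intro j hj v
      have h2 := congrFun (hN j hj) v
      have hfac : (j.factorial : ℂ) ≠ 0 := by exact_mod_cast j.factorial_ne_zero
      simpa [weightedComponent, hfac] using h2
    obtain ⟨C₄, hC₄0, hC₄⟩ := exists_norm_sub_leading_term_le N p₀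
      (analyticAt_weightedFamily_zero (by omega : 0 < m) hK p₀) hz
    have hty : Tendsto (fun t : ℝ => ((t : ℂ), y t)) (𝓝[>] 0) (𝓝 (0, p₀)) :=
      ((Complex.continuous_ofReal.tendsto' 0 0 (by simp)).comp ht0).prodMk_nhds hylim
    have hYc : Tendsto (fun t => Y (y t)) (𝓝[>] 0) (𝓝 (Y p₀)) :=
      (analyticAt_weightedComponent (by omega) hK N p₀).continuousAt.tendsto.comp hylim
    have hdiff : Tendsto (fun t : ℝ => (t ^ N)⁻¹ • weightedFamily m K ((t : ℂ), y t) - Y (y t))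
        (𝓝[>] 0) (𝓝 0) := by
      have hb : Tendsto (fun t : ℝ => C₄ * t) (𝓝[>] 0) (𝓝 0) := by simpa using ht0.const_mul C₄
      refine squeeze_zero_norm' ?_ hb
      filter_upwards [htpos, hty.eventually hC₄] with t ht h4
      have htN : 0 < t ^ N := by positivity
      have e1 : (t ^ N)⁻¹ • weightedFamily m K ((t : ℂ), y t) - Y (y t) = (t ^ N)⁻¹ •
          (weightedFamily m K ((t : ℂ), y t) - (t : ℂ) ^ N •
            (((N.factorial : ℂ))⁻¹ • paramDeriv^[N] (weightedFamily m K) (0, y t))) := by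
        rw [smul_sub, ← Complex.ofReal_pow, Complex.coe_smul, smul_smul, inv_mul_cancel₀ htN.ne',
          one_smul]
        rfl
      rw [e1, norm_smul, norm_inv, Real.norm_eq_abs, abs_of_pos htN, inv_mul_le_iff₀ htN]
      refine h4.trans (le_of_eq ?_)
      simp only [Complex.norm_real, Real.norm_eq_abs, abs_of_pos ht]
      ring
    simpa using hdiff.add hYc
  -- The first component of the family is `t ^ (m - 1) • (k t).1`, rewritten as `t ^ m` times the
  -- increment `t⁻¹ • (k t).1` at which `Q` is differentiated at `z`.
  have hA : Tendsto (fun t : ℝ => ((t ^ N)⁻¹ * t ^ m) • (t⁻¹ • (k t).1)) (𝓝[>] 0)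
      (𝓝 (Y p₀).1) := by
    refine ((continuous_fst.tendsto _).comp hlead).congr' ?_
    filter_upwards [htpos] with t ht
    simp only [Function.comp_apply, weightedFamily, Prod.smul_fst]
    rw [← Complex.ofReal_pow, Complex.coe_smul, smul_smul, smul_smul]
    congr 1
    have : t ^ m = t ^ (m - 1) * t := by rw [← pow_succ]; congr 1; omega
    rw [this]
    field_simp
  have hB : Tendsto (fun t : ℝ => (t ^ N)⁻¹ • (k t).2) (𝓝[>] 0) (𝓝 (Y p₀).2) := by
    refine ((continuous_snd.tendsto _).comp hlead).congr fun t => ?_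
    simp only [Function.comp_apply, weightedFamily, Prod.smul_snd, hk]
  have hBim : Tendsto (fun t : ℝ => (t ^ N)⁻¹ * (k t).2.im) (𝓝[>] 0) (𝓝 (Y p₀).2.im) := by
    refine ((Complex.continuous_im.tendsto _).comp hB).congr fun t => ?_
    simp only [Function.comp_apply, Complex.smul_im, smul_eq_mul]
  have hQlim : Tendsto (fun t : ℝ => ((t ^ N)⁻¹ * t ^ m) • (Q (z + t⁻¹ • (k t).1) - Q z)) (𝓝[>] 0)
      (𝓝 (fderiv ℝ Q z (Y p₀).1)) :=
    (hQd z).hasFDerivAt.hasFDerivWithinAt (s := Set.univ) |>.lim ha1 (by simp) hA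
  have hrlim : Tendsto (fun t : ℝ => (t ^ N)⁻¹ *
      (r ((x t).1 + (k t).1, (x t).2 + (k t).2.re) - r (x t))) (𝓝[>] 0) (𝓝 0) := by
    have hα : Tendsto (fun t : ℝ => t * ‖z‖ + ‖(k t).1‖) (𝓝[>] 0) (𝓝 0) := by
      simpa using (hcont (φ := fun t => t * ‖z‖) (by fun_prop) (by simp)).add ha0
    have hβ : Tendsto (fun t : ℝ => t ^ m * |u| + ‖(k t).2‖) (𝓝[>] 0) (𝓝 0) := by
      simpa using (hcont (φ := fun t => t ^ m * |u|) (by fun_prop)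
        (by simp [show m ≠ 0 by omega])).add hb0
    -- With `a` of size `t` and `b` of size `t ^ m`, the Lipschitz estimate leaves, after division
    -- by `t ^ N`, bounded quantities times factors tending to 0.
    have hbound : Tendsto (fun t : ℝ => C * (t * ‖((t ^ N)⁻¹ * t ^ m) • (t⁻¹ • (k t).1)‖ *
        ((‖z‖ + ‖t⁻¹ • (k t).1‖) ^ m + |u|) + ‖(t ^ N)⁻¹ • (k t).2‖ * ‖(k t).1‖ +
        ((t * ‖z‖ + ‖(k t).1‖) + (t ^ m * |u| + ‖(k t).2‖)) * ‖(t ^ N)⁻¹ • (k t).2‖))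
        (𝓝[>] 0) (𝓝 0) := by
      have h1 := (ht0.mul hA.norm).mul (((ha1.norm.const_add ‖z‖).pow m).add_const |u|)
      have h2 := hB.norm.mul ha0
      have h3 := (hα.add hβ).mul hB.norm
      have h4 := ((h1.add h2).add h3).const_mul C
      simpa using h4
    refine squeeze_zero_norm' ?_ hbound
    filter_upwards [htpos, hα.eventually (eventually_lt_nhds hε),
      hβ.eventually (eventually_lt_nhds hε)] with t ht hα hβ
    have htN : 0 < t ^ N := by positivity
    have h := hlip _ _ hα hβ ((x t).1 + (k t).1) (x t).1 ((x t).2 + (k t).2.re) (x t).2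
      ((norm_add_le _ _).trans (by rw [hxa t ht]))
      (by rw [hxa t ht]; linarith [norm_nonneg (k t).1])
      ((abs_add_le _ _).trans (by rw [hxb t ht]; linarith [Complex.abs_re_le_norm (k t).2]))
      (by rw [hxb t ht]; linarith [norm_nonneg (k t).2])
    rw [add_sub_cancel_left, add_sub_cancel_left] at h
    have hre := Complex.abs_re_le_norm (k t).2
    rw [norm_mul, norm_inv, Real.norm_eq_abs, abs_of_pos htN, Real.norm_eq_abs,
      inv_mul_le_iff₀ htN]
    refine h.trans ?_
    simp only [norm_smul, norm_mul, norm_inv, norm_pow, Real.norm_eq_abs, abs_of_pos ht]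
    have e1 : (t * ‖z‖ + ‖(k t).1‖) ^ m = t ^ m * (‖z‖ + t⁻¹ * ‖(k t).1‖) ^ m := by
      rw [← mul_pow]; congr 1; field_simp
    rw [e1]
    calc C * ((t ^ m * (‖z‖ + t⁻¹ * ‖(k t).1‖) ^ m + (t ^ m * |u| + ‖(k t).2‖)) * ‖(k t).1‖ +
          (t * ‖z‖ + ‖(k t).1‖ + (t ^ m * |u| + ‖(k t).2‖)) * |(k t).2.re|)
        ≤ C * ((t ^ m * (‖z‖ + t⁻¹ * ‖(k t).1‖) ^ m + (t ^ m * |u| + ‖(k t).2‖)) * ‖(k t).1‖ +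
          (t * ‖z‖ + ‖(k t).1‖ + (t ^ m * |u| + ‖(k t).2‖)) * ‖(k t).2‖) := by gcongr
      _ = _ := by field_simp; ring
  have hsum := hQlim.add hrlim
  rw [add_zero] at hsum
  refine tendsto_nhds_unique hBim (hsum.congr' ?_)
  filter_upwards [htpos, hx0.eventually hinv] with t ht hi
  have h := hi _ (hdil t ht)
  change Q (x t).1 + r (x t) + (k t).2.im = Q ((x t).1 + (k t).1) + _ at h
  have e1 : Q ((x t).1 + (k t).1) = t ^ m * Q (z + t⁻¹ • (k t).1) := by
    rw [← hQhom t ht, smul_add, smul_smul, mul_inv_cancel₀ ht.ne', one_smul]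
  have e2 : Q (x t).1 = t ^ m * Q z := hQhom t ht z
  rw [e1, e2] at h
  rw [smul_eq_mul]
  linear_combination (-(t ^ N)⁻¹) * h

/-! ### The inverse automorphism also preserves the hypersurface -/

/-- A local biholomorphism mapping a graph hypersurface, tangent to `Im w = 0` at the origin,
into itself also reflects membership in the hypersurface. -/
theorem IsLocalAutomorphism.eventually_mem_of_map_mem {ψ : (Fin n → ℂ) × ℝ → ℝ}
    (hψ : HasStrictFDerivAt ψ (0 : (Fin n → ℂ) × ℝ →L[ℝ] ℝ) 0) (hψ0 : ψ 0 = 0) {M : Set (Cn1 n)}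
    (hM : ∀ᶠ p : Cn1 n in 𝓝 0, p ∈ M ↔ p.2.im = ψ (p.1, p.2.re)) {F : Cn1 n → Cn1 n}
    (hF : IsLocalAutomorphism M F) : ∀ᶠ p in 𝓝 0, F p ∈ M → p ∈ M := by
  obtain ⟨hFa, hF0, ⟨G, hGa, hG0, -, hFG⟩, hFM⟩ := hF
  set base : Cn1 n →L[ℝ] (Fin n → ℂ) × ℝ :=
    (ContinuousLinearMap.fst ℝ (Fin n → ℂ) ℂ).prod
      (Complex.reCLM.comp (ContinuousLinearMap.snd ℝ (Fin n → ℂ) ℂ))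
  set ρ : Cn1 n → ℝ := fun p => p.2.im - ψ (p.1, p.2.re) with hρ
  set L : Cn1 n →L[ℝ] ℝ := Complex.imCLM.comp (ContinuousLinearMap.snd ℝ (Fin n → ℂ) ℂ)
  set A : Cn1 n →L[ℝ] Cn1 n := (fderiv ℂ F 0).restrictScalars ℝ with hA
  set proj : Cn1 n → Cn1 n := fun p => (p.1, p.2.re + I * ψ (p.1, p.2.re)) with hproj
  have hψb : HasStrictFDerivAt (fun p : Cn1 n => ψ (p.1, p.2.re)) (0 : Cn1 n →L[ℝ] ℝ) 0 := by
    have h1 : HasStrictFDerivAt ψ (0 : (Fin n → ℂ) × ℝ →L[ℝ] ℝ) (base 0) := by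
      rwa [map_zero]
    have h2 := h1.comp (0 : Cn1 n) base.hasStrictFDerivAt
    rw [ContinuousLinearMap.zero_comp] at h2
    exact h2
  have hρd : HasStrictFDerivAt ρ L 0 := by
    have h := (L.hasStrictFDerivAt (x := (0 : Cn1 n))).sub hψb
    rw [sub_zero] at h
    exact h
  have hFd : HasStrictFDerivAt F A 0 := hFa.hasStrictFDerivAt.restrictScalars ℝ
  have hρF : HasStrictFDerivAt (fun p => ρ (F p)) (L.comp A) 0 :=
    HasStrictFDerivAt.comp (0 : Cn1 n) (g := ρ) (by rwa [hF0]) hFd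
  have hproj0 : proj 0 = 0 := by
    have : ψ (0, 0) = 0 := hψ0
    simp [hproj, this]
  have hψc : ContinuousAt (fun p : Cn1 n => ψ (p.1, p.2.re)) 0 := hψb.hasFDerivAt.continuousAt
  have hprojc : Tendsto proj (𝓝 0) (𝓝 0) := by
    have h1 : ContinuousAt proj 0 := by
      refine continuousAt_fst.prodMk (ContinuousAt.add ?_ (continuousAt_const.mul ?_))
      · exact (Complex.continuous_ofReal.comp (Complex.continuous_re.comp continuous_snd)).continuousAt
      · exact Complex.continuous_ofReal.continuousAt.comp hψc
    simpa [ContinuousAt, hproj0] using h1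
  have hFc : Tendsto F (𝓝 0) (𝓝 0) := by simpa [ContinuousAt, hF0] using hFa.continuousAt
  have hMρ : ∀ᶠ p : Cn1 n in 𝓝 0, p ∈ M ↔ ρ p = 0 := by
    filter_upwards [hM] with p hp
    rw [hp, hρ, sub_eq_zero]
  have hprojM : ∀ᶠ p : Cn1 n in 𝓝 0, ρ (F (proj p)) = 0 := by
    filter_upwards [hprojc.eventually hMρ, hprojc.eventually hFM,
      (hFc.comp hprojc).eventually hMρ] with p h1 h2 h3
    refine h3.1 (h2 (h1.2 ?_))
    simp [hρ, hproj]
  have hprojd : HasFDerivAt proj ((ContinuousLinearMap.fst ℝ (Fin n → ℂ) ℂ).prod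
      (Complex.ofRealCLM.comp (Complex.reCLM.comp (ContinuousLinearMap.snd ℝ (Fin n → ℂ) ℂ)))) 0 := by
    have h1 : HasFDerivAt (fun p : Cn1 n => I * (ψ (p.1, p.2.re) : ℂ)) (0 : Cn1 n →L[ℝ] ℂ) 0 := by
      have := (Complex.ofRealCLM.hasFDerivAt.comp (0 : Cn1 n) hψb.hasFDerivAt).const_mul I
      exact this.congr_fderiv (ContinuousLinearMap.ext fun v => by simp)
    have h2 := (Complex.ofRealCLM.comp (Complex.reCLM.comp
      (ContinuousLinearMap.snd ℝ (Fin n → ℂ) ℂ))).hasFDerivAt (x := (0 : Cn1 n))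
    have h3 := (ContinuousLinearMap.fst ℝ (Fin n → ℂ) ℂ).hasFDerivAt (x := (0 : Cn1 n))
    simpa using h3.prodMk (h2.add h1)
  -- `ρ ∘ F` vanishes on the hypersurface, so its differential kills the tangent space `Im w = 0`.
  -- Since `fderiv ℂ F 0` is onto, it cannot also kill the normal direction `(0, I)`.
  have htan : ∀ (ζ : Fin n → ℂ) (s : ℝ), L (A (ζ, (s : ℂ))) = 0 := by
    intro ζ s
    have h1 : HasFDerivAt (fun p => ρ (F p)) (L.comp A) (proj 0) := by
      rw [hproj0]; exact hρF.hasFDerivAt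
    have h2 := h1.comp (0 : Cn1 n) hprojd
    have h3 : HasFDerivAt ((fun p => ρ (F p)) ∘ proj) (0 : Cn1 n →L[ℝ] ℝ) 0 :=
      (hasFDerivAt_const (0 : ℝ) (0 : Cn1 n)).congr_of_eventuallyEq hprojM
    have h4 := congrArg (fun T => T ((ζ, (s : ℂ)) : Cn1 n)) (h2.unique h3)
    simpa using h4
  have hnorm : L (A (0, I)) ≠ 0 := by
    intro h0
    have hFG' : HasFDerivAt (fun p => F (G p)) ((fderiv ℂ F 0).comp (fderiv ℂ G 0)) 0 :=
      HasFDerivAt.comp (0 : Cn1 n) (g := F) (by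
        rw [hG0]; exact hFa.differentiableAt.hasFDerivAt) hGa.differentiableAt.hasFDerivAt
    have hid : HasFDerivAt (fun p => F (G p)) (ContinuousLinearMap.id ℂ (Cn1 n)) 0 :=
      (hasFDerivAt_id (0 : Cn1 n)).congr_of_eventuallyEq hFG
    have h1 := congrArg (fun T => T ((0, I) : Cn1 n)) (hFG'.unique hid)
    simp only [ContinuousLinearMap.comp_apply, ContinuousLinearMap.id_apply] at h1
    set ξ : Cn1 n := fderiv ℂ G 0 (0, I)
    have hξ : ξ = (ξ.1, (ξ.2.re : ℂ)) + ξ.2.im • ((0, I) : Cn1 n) := by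
      refine Prod.ext (by simp) ?_
      simp [Complex.re_add_im]
    have h2 : L (A ξ) = 0 := by
      rw [hξ, map_add, map_add, map_smul, map_smul, htan, h0, smul_zero, add_zero]
    have h3 : L (A ξ) = 1 := by
      change (fderiv ℂ F 0 ξ).2.im = 1
      rw [h1]
      simp
    rw [h2] at h3
    exact zero_ne_one h3
  -- Strict differentiability compares `p` with its projection `proj p`, which differs from it by `ρ
  -- p • (0, I)`. If `ρ (F p) = 0`, then `|ρ p|` is at most half of itself.
  have hlo := (hρF.isLittleO).bound (half_pos (abs_pos.2 hnorm))
  have hpair : Tendsto (fun p : Cn1 n => (p, proj p)) (𝓝 0) (𝓝 (0, 0)) :=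
    tendsto_id.prodMk_nhds hprojc
  filter_upwards [hpair.eventually hlo, hprojM, hMρ, hFc.eventually hMρ] with p h1 h2 h3 h4 hp
  have hsub : p - proj p = ρ p • ((0, I) : Cn1 n) := by
    refine Prod.ext (by simp [hproj]) ?_
    simp only [hproj, hρ, Prod.snd_sub, Prod.smul_snd, Complex.real_smul]
    push_cast
    linear_combination -Complex.re_add_im p.2
  have hnI : ‖((0, I) : Cn1 n)‖ = 1 := by simp [Prod.norm_mk]
  simp only [hsub, h4.1 hp, h2, map_smul, norm_smul, hnI, sub_self, zero_sub, norm_neg,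
    Real.norm_eq_abs, mul_one, ContinuousLinearMap.comp_apply] at h1
  rw [h3]
  by_contra hne
  have hpos := abs_pos.2 hne
  have := abs_pos.2 hnorm
  nlinarith

/-! ### The sum-of-squares model -/

section SumOfSquares

variable (P : Fin k → MvPolynomial (Fin n) ℂ)

/-- The polynomial map `z ↦ (P₁(z), …, Pₖ(z))`. -/
noncomputable def polyMap (z : Fin n → ℂ) : Fin k → ℂ := fun l => MvPolynomial.eval z (P l)

lemma analyticOnNhd_polyMap : AnalyticOnNhd ℂ (polyMap P) Set.univ := fun z _ =>
  analyticAt_pi_iff.2 fun l => AnalyticOnNhd.eval_mvPolynomial (P l) z trivial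

lemma polyMap_smul (hP : ∀ l, (P l).IsHomogeneous d) (c : ℂ) (z : Fin n → ℂ) :
    polyMap P (c • z) = c ^ d • polyMap P z := by
  ext l
  simp only [polyMap, Pi.smul_apply, smul_eq_mul, MvPolynomial.eval_eq', Finset.mul_sum]
  refine Finset.sum_congr rfl fun s hs => ?_
  have hdeg : ∑ i, s i = d := by
    have := hP l (MvPolynomial.mem_support_iff.1 hs)
    simpa [Finsupp.weight_apply, Finsupp.sum_fintype] using this
  simp only [mul_pow, Finset.prod_mul_distrib, Finset.prod_pow_eq_pow_sum, hdeg]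
  ring

lemma sumOfSquares_eq (z : Fin n → ℂ) :
    (sumOfSquares P z : ℂ) = herm (polyMap P z) (polyMap P z) := by
  rw [herm_self]; rfl

lemma hasFDerivAt_sumOfSquares (z : Fin n → ℂ) :
    HasFDerivAt (sumOfSquares P) (∑ l, 2 • (innerSL ℝ (polyMap P z l)).comp
      ((ContinuousLinearMap.proj (R := ℝ) l).comp
        ((fderiv ℂ (polyMap P) z).restrictScalars ℝ))) z := by
  refine HasFDerivAt.fun_sum fun l _ => HasFDerivAt.norm_sq (f := fun z => polyMap P z l) ?_
  exact hasFDerivAt_pi'.1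
    ((analyticOnNhd_polyMap P z trivial).differentiableAt.hasFDerivAt.restrictScalars ℝ) l

lemma fderiv_sumOfSquares (z ξ : Fin n → ℂ) :
    fderiv ℝ (sumOfSquares P) z ξ =
      2 * (herm (fderiv ℂ (polyMap P) z ξ) (polyMap P z)).re := by
  rw [(hasFDerivAt_sumOfSquares P z).fderiv, herm, Complex.re_sum, Finset.mul_sum,
    _root_.sum_apply]
  refine Finset.sum_congr rfl fun l _ => ?_
  simp [Complex.inner]
  ring

lemma contDiff_sumOfSquares : ContDiff ℝ ∞ (sumOfSquares P) := by
  have h : ∀ l, ContDiff ℝ ∞ fun z => polyMap P z l := fun l =>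
    contDiff_iff_contDiffAt.2 fun z =>
      ((AnalyticOnNhd.eval_mvPolynomial (P l) z trivial).contDiffAt (n := ∞)).restrict_scalars ℝ
  exact ContDiff.sum fun l _ => (h l).norm_sq ℝ

/-- A holomorphic field annihilating all the `Pₗ` vanishes near the origin, if the model is
holomorphically nondegenerate. -/
lemma eventually_eq_zero_of_annihilates
    (hnondeg : HolomorphicallyNondegenerateAt (modelDefiningFunction (sumOfSquares P)) 0)
    {f : Cn1 n → Fin n → ℂ} (hf : AnalyticAt ℂ f 0)
    (h : ∀ x : Cn1 n, fderiv ℂ (polyMap P) x.1 (f x) = 0) : ∀ᶠ x in 𝓝 0, f x = 0 := by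
  have hρ : ∀ q v : Cn1 n, fderiv ℝ (modelDefiningFunction (sumOfSquares P)) q v =
      v.2.im - fderiv ℝ (sumOfSquares P) q.1 v.1 := by
    intro q v
    have h1 : HasFDerivAt (fun p : Cn1 n => p.2.im) (Complex.imCLM.comp
        (ContinuousLinearMap.snd ℝ (Fin n → ℂ) ℂ)) q :=
      (Complex.imCLM.comp (ContinuousLinearMap.snd ℝ (Fin n → ℂ) ℂ)).hasFDerivAt
    have h2 : HasFDerivAt (fun p : Cn1 n => sumOfSquares P p.1)
        ((fderiv ℝ (sumOfSquares P) q.1).comp (ContinuousLinearMap.fst ℝ (Fin n → ℂ) ℂ)) q :=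
      (hasFDerivAt_sumOfSquares P q.1).differentiableAt.hasFDerivAt.comp q hasFDerivAt_fst
    have h3 : HasFDerivAt (modelDefiningFunction (sumOfSquares P)) _ q := h1.sub h2
    rw [h3.fderiv]
    simp
  have := hnondeg (fun x => (f x, 0)) ⟨hf.prod analyticAt_const, Eventually.of_forall
    fun q _ => ⟨by simp [hρ, fderiv_sumOfSquares, h, herm], by
      simp [hρ, fderiv_sumOfSquares, h, herm]⟩⟩
  filter_upwards [this] with x hx
  exact (Prod.ext_iff.1 hx).1

end SumOfSquares

/-! ### Vanishing of all weighted components and conclusion -/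

/-- If `K` vanishes to third order at the origin and `id + K` maps a perturbation of a nondegenerate
sum-of-squares model into itself, then `K` vanishes near the origin. -/
theorem eventually_eq_zero_of_preserves_perturbation (hd : 1 ≤ d) (P : Fin k → MvPolynomial (Fin n) ℂ)
    (hP : ∀ l, (P l).IsHomogeneous d) (hQ : sumOfSquares P ≠ 0)
    (hnondeg : HolomorphicallyNondegenerateAt (modelDefiningFunction (sumOfSquares P)) 0)
    {r : (Fin n → ℂ) × ℝ → ℝ} (hr : ContDiffAt ℝ ∞ r 0)
    (hW : WeightedDerivativesVanish (2 * d) r) (hr0 : r 0 = 0) {K : Cn1 n → Cn1 n}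
    (hK : AnalyticAt ℂ K 0) (hK3 : K =O[𝓝 0] fun x => ‖x‖ ^ 3)
    (hinv : ∀ᶠ x : (Fin n → ℂ) × ℝ in 𝓝 0, ∀ y : Cn1 n,
      y = (x.1, x.2 + I * (sumOfSquares P x.1 + r x : ℝ)) →
      sumOfSquares P x.1 + r x + (K y).2.im =
        sumOfSquares P (x.1 + (K y).1) + r (x.1 + (K y).1, x.2 + (K y).2.re)) :
    ∀ᶠ x in 𝓝 0, K x = 0 := by
  have hm : 0 < 2 * d := by omega
  refine eventually_eq_zero_of_weightedComponent hm hK ?_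
  intro N
  induction N using Nat.strong_induction_on with
  | _ N hN =>
  have hQhom : ∀ t : ℝ, 0 < t → ∀ z, sumOfSquares P (t • z) = t ^ (2 * d) * sumOfSquares P z := by
    intro t _ z
    have h := polyMap_smul P hP (t : ℂ) z
    apply Complex.ofReal_injective
    rw [Complex.ofReal_mul, sumOfSquares_eq, sumOfSquares_eq, ← Complex.coe_smul, h, herm_smul_left,
      herm_smul_right, map_pow, Complex.conj_ofReal]
    push_cast
    ring
  have htan := tangency_of_leading_component (by omega : 2 ≤ 2 * d)
    (fun z => (hasFDerivAt_sumOfSquares P z).differentiableAt) hQhom hr hW hr0 hK hK3 hinv hN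
  set Y := weightedComponent (2 * d) N K
  have hYa : ∀ x, AnalyticAt ℂ Y x := analyticAt_weightedComponent hm hK N
  have hYd : Differentiable ℂ Y := fun x => (hYa x).differentiableAt
  have hY3 : Y =O[𝓝 0] fun x => ‖x‖ ^ 3 := weightedComponent_isBigO hm hK hK3 N
  have hf : Differentiable ℂ fun x => (Y x).1 := hYd.fst
  have hg : Differentiable ℂ fun x => (Y x).2 := hYd.snd
  have hp := analyticOnNhd_polyMap P
  have hom := polyMap_smul P hP
  have hne : ∃ z, polyMap P z ≠ 0 := by
    obtain ⟨z, hz⟩ := Function.ne_iff.1 hQ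
    refine ⟨z, fun h0 => hz ?_⟩
    have := sumOfSquares_eq P z
    rw [h0, herm_self_eq_zero.2 rfl] at this
    exact_mod_cast this
  have hann := annihilates_of_polarized (f := fun x => (Y x).1) (g := fun x => (Y x).2) hd hp hom hne
    hf hg (Asymptotics.IsBigO.trans (Asymptotics.isBigO_of_le _ fun x => norm_fst_le (Y x)) hY3)
    (Asymptotics.IsBigO.trans (Asymptotics.isBigO_of_le _ fun x => norm_snd_le (Y x)) hY3)
    (fun z η w σ h => polarized_tangency hp hf hg (fun z u => by
      have := htan z u
      rwa [fderiv_sumOfSquares, sumOfSquares_eq] at this) h)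
  have hfz := eventually_eq_zero_of_annihilates P hnondeg (f := fun x => (Y x).1)
    (analyticAt_fst.comp (hYa 0)) fun x => (hann x).2
  have hY0 : Y =ᶠ[𝓝 0] 0 := by
    filter_upwards [hfz] with x hx
    exact Prod.ext hx (hann x).1
  -- Nondegeneracy only gives vanishing near 0; the identity theorem extends it to the whole space.
  have hYon : AnalyticOnNhd ℂ Y Set.univ := fun x _ => hYa x
  funext x
  exact hYon.eqOn_zero_of_preconnected_of_eventuallyEq_zero isPreconnected_univ trivial hY0 trivial

lemma SameJet.isBigO_sub {F G : Cn1 n → Cn1 n} (hF : AnalyticAt ℂ F 0) (hG : AnalyticAt ℂ G 0)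
    {j : ℕ} (h : SameJet j F G 0) : (fun p => G p - F p) =O[𝓝 0] fun p => ‖p‖ ^ (j + 1) := by
  refine isBigO_pow_of_iteratedFDeriv_eq_zero (𝕜 := ℂ) (j + 1) (hG.sub hF).contDiffAt fun i hi => ?_
  have := iteratedFDeriv_sub_apply (i := i) (hG.contDiffAt (n := i)) (hF.contDiffAt (n := i))
  rw [← h i (by omega), sub_self] at this
  exact this

/-- First derivatives have weighted order `1/m` in `z` and `1` in `u`, both at most one. -/
lemma WeightedDerivativesVanish.hasStrictFDerivAt_zero {m : ℕ} (hm : 0 < m)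
    {r : (Fin n → ℂ) × ℝ → ℝ} (hr : ContDiffAt ℝ ∞ r 0) (hW : WeightedDerivativesVanish m r) :
    HasStrictFDerivAt r (0 : (Fin n → ℂ) × ℝ →L[ℝ] ℝ) 0 := by
  have h := hr.hasStrictFDerivAt (by simp)
  have h1 : (fderiv ℝ r 0).comp (ContinuousLinearMap.inl ℝ (Fin n → ℂ) ℝ) = 0 := by
    have e1 : fderiv ℝ (fun z : Fin n → ℂ => r (z, 0)) 0 =
        (fderiv ℝ r 0).comp (ContinuousLinearMap.inl ℝ (Fin n → ℂ) ℝ) :=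
      (HasFDerivAt.comp (0 : Fin n → ℂ) (g := r) h.hasFDerivAt
        (hasFDerivAt_prodMk_left (0 : Fin n → ℂ) (0 : ℝ))).fderiv
    rw [← e1, ← norm_eq_zero, ← norm_iteratedFDeriv_one,
      hW.iteratedFDeriv_comp_inl hm hr (by omega), norm_zero]
  have h2 : fderiv ℝ r 0 = 0 := by
    refine ContinuousLinearMap.ext fun v => ?_
    have hv : v = ContinuousLinearMap.inl ℝ (Fin n → ℂ) ℝ v.1 + v.2 • ((0, 1) : (Fin n → ℂ) × ℝ) := by
      refine Prod.ext ?_ ?_ <;> simp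
    have h3 := congrArg (fun T => T v.1) h1
    simp only [ContinuousLinearMap.comp_apply, _root_.zero_apply] at h3
    rw [hv, map_add, map_smul, hW.fderiv_inr, h3]
    simp
  rwa [h2] at h

end CRModel

theorem theorem1p8 {n k d : ℕ} (hd : 1 ≤ d)
    (P : Fin k → MvPolynomial (Fin n) ℂ)
    (hP : ∀ l, (P l).IsHomogeneous d)
    (hQ : CRModel.sumOfSquares P ≠ 0)
    (hnondeg : CRModel.HolomorphicallyNondegenerateAt
      (CRModel.modelDefiningFunction (CRModel.sumOfSquares P)) 0)
    (M : Set (CRModel.Cn1 n))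
    (hM : CRModel.IsSmoothPerturbation (2 * d) (CRModel.sumOfSquares P) M)
    (F G : CRModel.Cn1 n → CRModel.Cn1 n)
    (hF : CRModel.IsLocalAutomorphism M F) (hG : CRModel.IsLocalAutomorphism M G)
    (hjet : CRModel.SameJet 2 F G 0) :
    F =ᶠ[𝓝 0] G := by
  open CRModel in
  obtain ⟨ψ, ⟨U, hU, h0U, hψU⟩, hW, hMψ⟩ := hM
  have hm : 0 < 2 * d := by omega
  have hψ : ContDiffAt ℝ ∞ ψ 0 := hψU.contDiffAt (hU.mem_nhds h0U)
  have hp0 : polyMap P 0 = 0 := by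
    have := polyMap_smul P hP 0 0
    rwa [smul_zero, zero_pow (by omega), zero_smul] at this
  have hQ0 : sumOfSquares P 0 = 0 := by
    have := sumOfSquares_eq P 0
    rw [hp0, herm_self_eq_zero.2 rfl] at this
    exact_mod_cast this
  set r : (Fin n → ℂ) × ℝ → ℝ := fun x => ψ x - sumOfSquares P x.1 with hr_def
  have hQfst : ContDiffAt ℝ ∞ (fun x : (Fin n → ℂ) × ℝ => sumOfSquares P x.1) 0 :=
    ((contDiff_sumOfSquares P).comp contDiff_fst).contDiffAt
  have hr : ContDiffAt ℝ ∞ r 0 := hψ.sub hQfst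
  have hr0 : r 0 = 0 := by
    have := hW.iteratedFDeriv_comp_inl hm hr (Nat.zero_le _)
    rw [← norm_eq_zero, norm_iteratedFDeriv_zero, norm_eq_zero] at this
    exact this
  have hψ0 : ψ 0 = 0 := by
    have : r 0 = ψ 0 - sumOfSquares P 0 := rfl
    rw [hr0, hQ0, sub_zero] at this
    exact this.symm
  have hψr : ∀ x, ψ x = sumOfSquares P x.1 + r x := fun x => by simp [hr_def]
  have hψd : HasStrictFDerivAt ψ (0 : (Fin n → ℂ) × ℝ →L[ℝ] ℝ) 0 := by
    have h1 := hQfst.hasStrictFDerivAt (by simp)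
    have h2 : fderiv ℝ (fun x : (Fin n → ℂ) × ℝ => sumOfSquares P x.1) 0 = 0 := by
      have h3 : HasFDerivAt (fun x : (Fin n → ℂ) × ℝ => sumOfSquares P x.1)
          ((fderiv ℝ (sumOfSquares P) 0).comp (ContinuousLinearMap.fst ℝ (Fin n → ℂ) ℝ)) 0 :=
        HasFDerivAt.comp (0 : (Fin n → ℂ) × ℝ) (g := sumOfSquares P)
          (hasFDerivAt_sumOfSquares P 0).differentiableAt.hasFDerivAt hasFDerivAt_fst
      rw [h3.fderiv]
      refine ContinuousLinearMap.ext fun v => ?_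
      simp [fderiv_sumOfSquares, hp0, herm]
    rw [h2] at h1
    have h4 := h1.add (hW.hasStrictFDerivAt_zero hm hr)
    rw [add_zero] at h4
    exact h4.congr_of_eventuallyEq (Eventually.of_forall fun x => (hψr x).symm)
  have hback := hF.eventually_mem_of_map_mem hψd hψ0 hMψ
  obtain ⟨hFa, hF0, ⟨F', hF'a, hF'0, hF'F, hFF'⟩, -⟩ := hF
  obtain ⟨hGa, hG0, -, hGM⟩ := hG
  have hGc : Tendsto G (𝓝 0) (𝓝 0) := by simpa [ContinuousAt, hG0] using hGa.continuousAt
  have hFc : Tendsto F (𝓝 0) (𝓝 0) := by simpa [ContinuousAt, hF0] using hFa.continuousAt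
  have hF'c : Tendsto F' (𝓝 0) (𝓝 0) := by simpa [ContinuousAt, hF'0] using hF'a.continuousAt
  have hHc : Tendsto (fun p => F' (G p)) (𝓝 0) (𝓝 0) := hF'c.comp hGc
  -- Here `F'` is the inverse germ of `F`. Since `p = F' (F p)`, local Lipschitz continuity of `F'`
  -- bounds `K` by `G - F`, which is of third order.
  set K : Cn1 n → Cn1 n := fun p => F' (G p) - p with hK_def
  have hKa : AnalyticAt ℂ K 0 :=
    (AnalyticAt.comp (g := F') (by rwa [hG0]) hGa).sub analyticAt_id
  have hK3 : K =O[𝓝 0] fun x => ‖x‖ ^ 3 := by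
    have h1 := hjet.isBigO_sub hFa hGa
    obtain ⟨L, t, ht, hL⟩ := (hF'a.contDiffAt (n := 1)).exists_lipschitzOnWith
    refine Asymptotics.IsBigO.trans (Asymptotics.IsBigO.of_bound L ?_) h1
    filter_upwards [hGc ht, hFc ht, hF'F] with p hp1 hp2 hp3
    have := hL.dist_le_mul _ hp1 _ hp2
    rwa [dist_eq_norm, dist_eq_norm, hp3] at this
  have hHM : ∀ᶠ p in 𝓝 0, p ∈ M → F' (G p) ∈ M := by
    filter_upwards [hGM, hGc.eventually hFF', hHc.eventually hback] with p h1 h2 h3 hp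
    exact h3 (by rw [h2]; exact h1 hp)
  have hgraph : ∀ᶠ p in 𝓝 0, p.2.im = ψ (p.1, p.2.re) →
      (F' (G p)).2.im = ψ ((F' (G p)).1, (F' (G p)).2.re) := by
    filter_upwards [hHM, hMψ, hHc.eventually hMψ] with p h1 h2 h3 hp
    exact h3.1 (h1 (h2.2 hp))
  have hcurve : Tendsto (fun x : (Fin n → ℂ) × ℝ =>
      ((x.1, x.2 + Complex.I * (sumOfSquares P x.1 + r x : ℝ)) : Cn1 n)) (𝓝 0) (𝓝 0) := by
    simp only [← hψr]
    have h1 : ContinuousAt (fun x : (Fin n → ℂ) × ℝ =>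
        ((x.1, x.2 + Complex.I * (ψ x : ℝ)) : Cn1 n)) 0 := by
      have := hψ.continuousAt
      fun_prop
    refine (h1.tendsto).trans (le_of_eq (congrArg 𝓝 ?_))
    exact Prod.ext (by simp) (by simp [hψ0])
  have hinv : ∀ᶠ x : (Fin n → ℂ) × ℝ in 𝓝 0, ∀ y : Cn1 n,
      y = (x.1, x.2 + Complex.I * (sumOfSquares P x.1 + r x : ℝ)) →
      sumOfSquares P x.1 + r x + (K y).2.im =
        sumOfSquares P (x.1 + (K y).1) + r (x.1 + (K y).1, x.2 + (K y).2.re) := by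
    filter_upwards [hcurve.eventually hgraph] with x hx y hy
    replace hx : y.2.im = ψ (y.1, y.2.re) →
        (F' (G y)).2.im = ψ ((F' (G y)).1, (F' (G y)).2.re) := by
      subst hy
      exact hx
    have h1 : y.1 = x.1 := by rw [hy]
    have h2 : y.2.re = x.2 := by rw [hy]; simp
    have h3 : y.2.im = sumOfSquares P x.1 + r x := by rw [hy]; simp
    have h4 : F' (G y) = y + K y := by simp [hK_def]
    rw [h1, h2, h3, h4] at hx
    have h5 := hx (hψr x).symm
    rw [hψr] at h5
    simpa [h1, h2, h3] using h5
  have hK0 := eventually_eq_zero_of_preserves_perturbation hd P hP hQ hnondeg hr hW hr0 hKa hK3 hinv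
  filter_upwards [hK0, hGc.eventually hFF'] with p h1 h2
  rw [sub_eq_zero.1 h1] at h2
  exact h2
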